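/- Let $N\ge 2$ be an integer, $I=(0,1)$, $\dot H^1=\{v\in H^1(I): v(1)=0\}$ (functions in $H^1(I)$ are identified with their continuous representatives), and $$(w,v)=\int_0^1 x^{N-1}wv\,dx,\qquad A(w,v)=\int_0^1 x^{N-1}w'v'\,dx .$$ Let $\mu$ be the smallest eigenvalue of the problem: find $\lambda\in\mathbb R$ and $0\ne\psi\in\dot H^1$ with $A(\psi,\chi)=\lambda(\psi,\chi)$ for all $\chi\in\dot H^1$. Let $\psi$ be an eigenfunction for $\mu$, normalized by $\psi\ge 0$ and $\int_0^1x^{N-1}\psi\,dx=1$. For a partition $0=x_0<x_1<\dots<x_m=1$, $m\ge1$, let $h=\max_{1\le j\le m}(x_j-x_{j-1})$, let $S_h$ be the space of all $v\in H^1(I)$ with $v(1)=0$ that are polynomials of degree at most $1$ on each $(x_{j-1},x_j)$, let $\phi_i$ be the continuous function on $[0,1]$ that is affine on each $[x_{j-1},x_j]$ with $\phi_i(x_j)=\delta_{ij}$, and put $$\langle w,v\rangle=\sum_{i=0}^{m-1}w(x_i)v(x_i)\,(1,\phi_i).$$ Consider the eigenvalue problem: find $\hat\lambda\in\mathbb R$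 and $0\ne\hat\psi_h\in S_h$ with $A(\hat\psi_h,\chi)=\hat\lambda\langle\hat\psi_h,\chi\rangle$ for all $\chi\in S_h$. Fix $\beta>0$ and consider only quasi-uniform partitions, that is, those with $h\le\beta\min_{1\le j\le m}(x_j-x_{j-1})$. Then the discrete problem has a smallest eigenvalue $\hat\mu_h$, and $\hat\mu_h>0$. Moreover: (i) $\hat\mu_h\to\mu$ as $h\to0$. (ii) Every eigenfunction $\hat\psi_h$ for $\hat\mu_h$ satisfies $\hat\psi_h\ge0$ on $[0,1]$ or $\hat\psi_h\le0$ on $[0,1]$. (iii) If $\hat\psi_h$ is the eigenfunction for $\hat\mu_h$ normalized by $\hat\psi_h\ge0$ and $\int_0^1x^{N-1}\hat\psi_h\,dx=1$, then $A(\hat\psi_h-\psi,\hat\psi_h-\psi)^{1/2}\to0$ as $h\to0$. The limits in (i) and (iii) are uniform over the partitions considered: for every $\varepsilon>0$ there is $\delta>0$, depending only on $\varepsilon$, $N$ and $\beta$, such that the quantity is within $\varepsilon$ of its limit for every such partition with $h<\delta$. -/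

import Mathlib

noncomputable section

namespace RadialFEM

/-- The weighted inner product `(w, v) = ∫₀¹ x^(N-1) w v dx`. -/
def wInner (N : ℕ) (w v : ℝ → ℝ) : ℝ :=
  ∫ x in (0 : ℝ)..1, x ^ (N - 1) * (w x * v x)

/-- The bilinear form `A(w, v) = ∫₀¹ x^(N-1) w' v' dx`. -/
def aForm (N : ℕ) (w v : ℝ → ℝ) : ℝ :=
  ∫ x in (0 : ℝ)..1, x ^ (N - 1) * (deriv w x * deriv v x)

/-- The weighted `H¹` seminorm `‖v'‖ = A(v, v)^(1/2)`. -/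
def energySeminorm (N : ℕ) (v : ℝ → ℝ) : ℝ :=
  Real.sqrt (aForm N v v)

/-- The (unweighted) Sobolev space `H¹(I)`, `I = (0, 1)`. Its elements are identified with their
continuous representatives, which are the absolutely continuous functions on `[0, 1]` whose
derivative, which exists almost everywhere and is the weak derivative, is square integrable.
Values outside `[0, 1]` play no role. -/
def MemH1 (v : ℝ → ℝ) : Prop :=
  AbsolutelyContinuousOnInterval v 0 1 ∧
    MeasureTheory.MemLp (deriv v) 2 (MeasureTheory.volume.restrict (Set.Ioo (0 : ℝ) 1))

/-- The space of all `v ∈ H¹(I)` with `v(1) = 0`. -/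
def MemH1dot (v : ℝ → ℝ) : Prop :=
  MemH1 v ∧ v 1 = 0

/-- `ψ` is an eigenfunction, with eigenvalue `lam`, of the weighted continuous problem. -/
def IsEigenfunction (N : ℕ) (lam : ℝ) (ψ : ℝ → ℝ) : Prop :=
  MemH1dot ψ ∧ (∃ x ∈ Set.Icc (0 : ℝ) 1, ψ x ≠ 0) ∧
    ∀ χ : ℝ → ℝ, MemH1dot χ → aForm N ψ χ = lam * wInner N ψ χ

/-- The set of eigenvalues of the weighted continuous problem. -/
def eigenvalues (N : ℕ) : Set ℝ :=
  {lam | ∃ ψ : ℝ → ℝ, IsEigenfunction N lam ψ}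

/-- A partition `0 = x₀ < x₁ < ⋯ < x_m = 1` of `[0, 1]`, with `m ≥ 1`.
Values of `node` at indices larger than `m` play no role. -/
structure Mesh where
  m : ℕ
  m_pos : 0 < m
  node : ℕ → ℝ
  node_zero : node 0 = 0
  node_last : node m = 1
  node_lt : ∀ j < m, node j < node (j + 1)

namespace Mesh

variable (M : Mesh)

/-- The length of the element between `node j` and `node (j + 1)`, for `j < m`. -/
def step (j : ℕ) : ℝ :=
  M.node (j + 1) - M.node j

/-- The granularity `h`, the largest length of an element. -/
def h : ℝ :=
  (Finset.range M.m).sup' (Finset.nonempty_range_iff.mpr M.m_pos.ne') M.step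

/-- Quasi-uniformity with constant `β`: `h ≤ β * min_j h_j`. -/
def QuasiUniform (β : ℝ) : Prop :=
  M.h ≤ β * (Finset.range M.m).inf' (Finset.nonempty_range_iff.mpr M.m_pos.ne') M.step

/-- The finite element space `S_h`: functions in `H¹(I)` vanishing at `1` which are polynomials of
degree at most one on every element. -/
def MemS (v : ℝ → ℝ) : Prop :=
  MemH1 v ∧
    (∀ j < M.m, ∃ a b : ℝ, ∀ x ∈ Set.Ioo (M.node j) (M.node (j + 1)), v x = a + b * x) ∧
    v 1 = 0

open Classical in
/-- The hat function `φ_i`, for `i < m`: it is affine on every element, equal to `1` at the `i`-th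
node and to `0` at all other nodes (there is no left part if `i = 0`). -/
def hat (i : ℕ) (x : ℝ) : ℝ :=
  if 0 < i ∧ M.node (i - 1) ≤ x ∧ x ≤ M.node i then
    (x - M.node (i - 1)) / (M.node i - M.node (i - 1))
  else if M.node i ≤ x ∧ x ≤ M.node (i + 1) then
    (M.node (i + 1) - x) / (M.node (i + 1) - M.node i)
  else 0

/-- The mass-lumped form `⟨w, v⟩ = ∑_{i=0}^{m-1} w(x_i) v(x_i) (1, φ_i)`. -/
def lumped (N : ℕ) (w v : ℝ → ℝ) : ℝ :=
  ∑ i ∈ Finset.range M.m, w (M.node i) * v (M.node i) * wInner N (fun _ => 1) (M.hat i)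

/-- `ψ` is an eigenfunction, with eigenvalue `lam`, of the lumped discrete problem. -/
def IsEigenfunction (N : ℕ) (lam : ℝ) (ψ : ℝ → ℝ) : Prop :=
  M.MemS ψ ∧ (∃ x ∈ Set.Icc (0 : ℝ) 1, ψ x ≠ 0) ∧
    ∀ χ : ℝ → ℝ, M.MemS χ → aForm N ψ χ = lam * M.lumped N ψ χ

/-- The set of eigenvalues of the lumped discrete problem. -/
def eigenvalues (N : ℕ) : Set ℝ :=
  {lam | ∃ ψ : ℝ → ℝ, M.IsEigenfunction N lam ψ}

end Mesh

/-- Normalization of a first eigenfunction: `v ≥ 0` on `[0, 1]` and `∫₀¹ x^(N-1) v dx = 1`. -/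
def IsNormalized (N : ℕ) (v : ℝ → ℝ) : Prop :=
  (∀ x ∈ Set.Icc (0 : ℝ) 1, 0 ≤ v x) ∧ ∫ x in (0 : ℝ)..1, x ^ (N - 1) * v x = 1

end RadialFEM

end

noncomputable section

open MeasureTheory

namespace RadialFEM

/-! Integrated once from the origin, the continuous equation becomes `v' = -λ * flux v`, where `flux
v y = y^(1-N) ∫₀^y x^(N-1) v`. The proof shows that the discrete first eigenfunction satisfies the
same first-order equation with an `O(h)` residual, and then compares solutions.

In nodal values the lumped problem is an eigenvalue problem for a weighted chain: positive
couplings, a diagonal positive mass matrix, and a Dirichlet condition at the last node. Compactness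
gives a minimizer of the Rayleigh quotient. Taking absolute values does not increase that quotient,
and the three-term recurrence determines an eigenvector from its first entry, so first eigenvectors
have one sign.

Testing with the indicator of the first nodes expresses each slope through a partial sum of lumped
masses. For piecewise affine functions this sum is an exact integral up to a half-element term
(`Mesh.IsPiecewiseAffine.sum_nodalMass`). Hence `|v' + lam * flux v| ≤ lam * N * h * v 0` almost
everywhere, up to the degenerate point `x = 0` (`Mesh.IsEigenfunction.abs_slope_add_flux_le`).

For the eigenvalue, pairing this residual with `ψ'` gives `(μ - lam) (ψ, v) = O(h)`. Both functions
stay above half of their maximum on a common interval at the origin, so `(ψ, v)` is bounded below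
and `lam - μ = O(h)`. For the eigenfunction, `w = ψ(0) v - v(0) ψ` vanishes at `0` and satisfies
`|w'| ≤ Λ |flux w| + O(h)`. A Grönwall argument makes `w` small, the two normalizations then make
`v(0)` close to `ψ(0)`, and `v' - ψ'` is uniformly small. The constants involve only `N`, `μ` and
`ψ`, so the limits are uniform over partitions. -/

/-- The stiffness form of a chain with couplings `a k` between `k` and `k + 1`. -/
def chainForm (a : ℕ → ℝ) (m : ℕ) (u w : ℕ → ℝ) : ℝ :=
  ∑ k ∈ Finset.range m, a k * ((u (k + 1) - u k) * (w (k + 1) - w k))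

/-- The diagonal form with masses `b`. -/
def massForm (b : ℕ → ℝ) (m : ℕ) (u w : ℕ → ℝ) : ℝ :=
  ∑ i ∈ Finset.range m, u i * w i * b i

/-- `u` vanishes at `m` and solves the eigenvalue equation of the chain. -/
def IsChainEigenvector (a b : ℕ → ℝ) (m : ℕ) (lam : ℝ) (u : ℕ → ℝ) : Prop :=
  u m = 0 ∧ ∀ w : ℕ → ℝ, w m = 0 → chainForm a m u w = lam * massForm b m u w

/-- `lam` is a lower bound of the Rayleigh quotient of the chain. -/
def IsRayleighBound (a b : ℕ → ℝ) (m : ℕ) (lam : ℝ) : Prop :=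
  ∀ w : ℕ → ℝ, w m = 0 → lam * massForm b m w w ≤ chainForm a m w w

/-! ### Rayleigh quotient and first eigenvector of a weighted chain -/

section Chain

variable {a b : ℕ → ℝ} {m : ℕ} {lam : ℝ} {u v w : ℕ → ℝ}

lemma chainForm_congr (hu : ∀ k ≤ m, u k = v k) : chainForm a m u u = chainForm a m v v := by
  refine Finset.sum_congr rfl fun k hk => ?_
  have := Finset.mem_range.1 hk
  rw [hu k (by omega), hu (k + 1) (by omega)]

lemma massForm_congr (hu : ∀ k < m, u k = v k) : massForm b m u u = massForm b m v v := by
  refine Finset.sum_congr rfl fun k hk => ?_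
  rw [hu k (Finset.mem_range.1 hk)]

lemma chainForm_smul (c : ℝ) :
    chainForm a m (fun k => c * u k) (fun k => c * u k) = c ^ 2 * chainForm a m u u := by
  rw [chainForm, chainForm, Finset.mul_sum]
  exact Finset.sum_congr rfl fun k _ => by ring

lemma massForm_smul (c : ℝ) :
    massForm b m (fun k => c * u k) (fun k => c * u k) = c ^ 2 * massForm b m u u := by
  rw [massForm, massForm, Finset.mul_sum]
  exact Finset.sum_congr rfl fun k _ => by ring

lemma chainForm_add_smul (t : ℝ) :
    chainForm a m (fun k => u k + t * w k) (fun k => u k + t * w k) =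
      chainForm a m u u + 2 * t * chainForm a m u w + t ^ 2 * chainForm a m w w := by
  simp only [chainForm, Finset.mul_sum, ← Finset.sum_add_distrib]
  exact Finset.sum_congr rfl fun k _ => by ring

lemma massForm_add_smul (t : ℝ) :
    massForm b m (fun k => u k + t * w k) (fun k => u k + t * w k) =
      massForm b m u u + 2 * t * massForm b m u w + t ^ 2 * massForm b m w w := by
  simp only [massForm, Finset.mul_sum, ← Finset.sum_add_distrib]
  exact Finset.sum_congr rfl fun k _ => by ring

lemma massForm_self_pos (hb : ∀ i < m, 0 < b i) (hu : ∃ i < m, u i ≠ 0) :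
    0 < massForm b m u u := by
  obtain ⟨i, hi, hne⟩ := hu
  refine Finset.sum_pos' (fun j hj =>
    mul_nonneg (mul_self_nonneg _) (hb j (Finset.mem_range.1 hj)).le)
    ⟨i, Finset.mem_range.2 hi, mul_pos (mul_self_pos.2 hne) (hb i hi)⟩

/-- Compactness in the product space of all sequences: the irrelevant entries from index `m` on are
frozen at zero, and the mass constraint bounds the remaining ones. -/
lemma exists_isMinOn_chainForm (a : ℕ → ℝ) (hm : 0 < m) (hb : ∀ i < m, 0 < b i) :
    ∃ u : ℕ → ℝ, u m = 0 ∧ massForm b m u u = 1 ∧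
      ∀ w : ℕ → ℝ, w m = 0 → massForm b m w w = 1 → chainForm a m u u ≤ chainForm a m w w := by
  set K : Set (ℕ → ℝ) := {u | (∀ k, m ≤ k → u k = 0) ∧ massForm b m u u = 1} with hK
  have hclosed : IsClosed K := by
    have h1 : IsClosed {u : ℕ → ℝ | ∀ k, m ≤ k → u k = 0} := by
      simp only [Set.ofPred_forall]
      exact isClosed_iInter fun k => isClosed_iInter fun _ =>
        isClosed_eq (continuous_apply k) continuous_const
    have h2 : IsClosed {u : ℕ → ℝ | massForm b m u u = 1} := by
      refine isClosed_eq ?_ continuous_const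
      unfold massForm
      fun_prop
    exact h1.inter h2
  have hcompact : IsCompact K := by
    -- The half-width `1 + |1 / b k|` avoids a square root, since `|t| ≤ 1 + t ^ 2`; the absolute
    -- value keeps it positive also for `k ≥ m`, where `b k` is arbitrary.
    refine (isCompact_univ_pi fun k => isCompact_Icc (a := -(1 + |1 / b k|))
      (b := 1 + |1 / b k|)).of_isClosed_subset hclosed fun u hu k _ => ?_
    rw [Set.mem_Icc, ← abs_le]
    rcases lt_or_ge k m with hk | hk
    · have h1 : u k * u k * b k ≤ 1 := by
        rw [← hu.2]
        exact Finset.single_le_sum (f := fun i => u i * u i * b i)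
          (fun i hi => mul_nonneg (mul_self_nonneg _) (hb i (Finset.mem_range.1 hi)).le)
          (Finset.mem_range.2 hk)
      have h2 : u k * u k ≤ 1 / b k := (le_div_iff₀ (hb k hk)).2 h1
      have h3 := le_abs_self (1 / b k)
      rw [← abs_mul_abs_self] at h2
      nlinarith [sq_nonneg (|u k| - 1), abs_nonneg (u k)]
    · rw [hu.1 k hk, abs_zero]
      positivity
  have hne : K.Nonempty := by
    refine ⟨fun k => if k = 0 then (Real.sqrt (b 0))⁻¹ else 0, fun k hk => ?_, ?_⟩
    · simp [show k ≠ 0 by omega]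
    · rw [massForm, Finset.sum_eq_single 0]
      · rw [if_pos rfl, ← mul_inv, Real.mul_self_sqrt (hb 0 hm).le, inv_mul_cancel₀ (hb 0 hm).ne']
      · intro i _ hi
        simp [hi]
      · intro h
        exact absurd (Finset.mem_range.2 hm) h
  have hcont : ContinuousOn (fun u => chainForm a m u u) K := by
    unfold chainForm
    fun_prop
  obtain ⟨u, hu, hmin⟩ := hcompact.exists_isMinOn hne hcont
  refine ⟨u, hu.1 m le_rfl, hu.2, fun w hw hw1 => ?_⟩
  have key := hmin (a := fun k => if k < m then w k else 0) (by
    refine ⟨fun k hk => by simp [not_lt.2 hk], ?_⟩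
    rw [← hw1]
    exact massForm_congr fun k hk => by simp [hk])
  refine le_trans key (le_of_eq (chainForm_congr fun k hk => ?_))
  rcases hk.lt_or_eq with h | rfl
  · simp [h]
  · simp [hw]

/-- The Rayleigh quotient of the chain attains its infimum. -/
lemma exists_rayleigh_min (a : ℕ → ℝ) (hm : 0 < m) (hb : ∀ i < m, 0 < b i) :
    ∃ u : ℕ → ℝ, u m = 0 ∧ massForm b m u u = 1 ∧ IsRayleighBound a b m (chainForm a m u u) := by
  obtain ⟨u, hu0, hu1, hmin⟩ := exists_isMinOn_chainForm a hm hb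
  refine ⟨u, hu0, hu1, fun w hw => ?_⟩
  by_cases h : ∃ i < m, w i ≠ 0
  · have hpos := massForm_self_pos hb h
    set c := (Real.sqrt (massForm b m w w))⁻¹ with hc
    have hc2 : c ^ 2 * massForm b m w w = 1 := by
      rw [hc, inv_pow, Real.sq_sqrt hpos.le, inv_mul_cancel₀ hpos.ne']
    have := hmin (fun k => c * w k) (by simp [hw]) (by rw [massForm_smul, hc2])
    rw [chainForm_smul] at this
    calc _ ≤ c ^ 2 * chainForm a m w w * massForm b m w w := by gcongr
      _ = (c ^ 2 * massForm b m w w) * chainForm a m w w := by ring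
      _ = _ := by rw [hc2, one_mul]
  · push Not at h
    have h0 : ∀ k ≤ m, w k = 0 := fun k hk => by
      rcases hk.lt_or_eq with h' | rfl
      exacts [h k h', hw]
    have e1 : massForm b m w w = 0 := Finset.sum_eq_zero fun i hi => by
      simp [h i (Finset.mem_range.1 hi)]
    have e2 : chainForm a m w w = 0 := Finset.sum_eq_zero fun i hi => by
      have := Finset.mem_range.1 hi
      simp [h0 i (by omega), h0 (i + 1) (by omega)]
    simp [e1, e2]

/-- A minimizer of the Rayleigh quotient is an eigenvector. -/
lemma IsRayleighBound.isChainEigenvector (h : IsRayleighBound a b m lam) (hu0 : u m = 0)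
    (hu : chainForm a m u u ≤ lam * massForm b m u u) : IsChainEigenvector a b m lam u := by
  refine ⟨hu0, fun w hw => ?_⟩
  -- Perturbing `u` to `u + t w` gives a nonnegative quadratic in `t`; its constant term may be
  -- dropped because `hu` makes it nonpositive. A zero constant term forces the linear coefficient
  -- to vanish.
  have key : ∀ t : ℝ, 0 ≤ (chainForm a m w w - lam * massForm b m w w) * (t * t) +
      2 * (chainForm a m u w - lam * massForm b m u w) * t + 0 := by
    intro t
    have := h (fun k => u k + t * w k) (by simp [hu0, hw])
    rw [chainForm_add_smul, massForm_add_smul] at this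
    nlinarith
  have := discrim_le_zero key
  rw [discrim] at this
  have h2 : (chainForm a m u w - lam * massForm b m u w) ^ 2 ≤ 0 := by nlinarith
  have := pow_eq_zero_iff (two_ne_zero) |>.1 (le_antisymm h2 (sq_nonneg _))
  linarith

/-- Testing with the indicator of `{0, …, k}`. -/
lemma IsChainEigenvector.flux (h : IsChainEigenvector a b m lam u) {k : ℕ} (hk : k < m) :
    a k * (u k - u (k + 1)) = lam * ∑ i ∈ Finset.range (k + 1), u i * b i := by
  have := h.2 (fun i => if i ≤ k then 1 else 0) (by simp [hk])
  rw [chainForm, massForm, Finset.sum_eq_single k] at this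
  · simp only [le_refl, if_true, Nat.not_succ_le_self, if_false] at this
    rw [show a k * (u k - u (k + 1)) = a k * ((u (k + 1) - u k) * (0 - 1)) by ring, this]
    congr 1
    rw [← Finset.sum_subset (Finset.range_mono (show k + 1 ≤ m from hk))]
    · refine Finset.sum_congr rfl fun i hi => ?_
      rw [if_pos (Nat.lt_succ_iff.1 (Finset.mem_range.1 hi)), mul_one]
    · intro i _ hi
      rw [if_neg (by simpa [Nat.lt_succ_iff] using hi)]
      simp
  · intro i _ hi
    rcases lt_or_gt_of_ne hi with h' | h'
    · rw [if_pos (Nat.succ_le_of_lt h'), if_pos h'.le]; simp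
    · rw [if_neg (by omega), if_neg (by omega)]; simp
  · intro h'
    exact absurd (Finset.mem_range.2 hk) h'

/-- An eigenvector is determined by its eigenvalue and its first entry. -/
lemma IsChainEigenvector.ext (ha : ∀ k < m, 0 < a k) (hu : IsChainEigenvector a b m lam u)
    (hv : IsChainEigenvector a b m lam v) (h0 : u 0 = v 0) : ∀ k ≤ m, u k = v k := by
  intro k
  induction k using Nat.strong_induction_on with
  | _ k ih =>
    intro hk
    rcases k with _ | k
    · exact h0
    · have e1 := hu.flux (k := k) hk
      have e2 := hv.flux (k := k) hk
      rw [Finset.sum_congr rfl fun i hi => by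
        rw [ih i (Finset.mem_range.1 hi) (by have := Finset.mem_range.1 hi; omega)]] at e1
      rw [← e2, ih k (by omega) (by omega)] at e1
      have := mul_left_cancel₀ (ha k hk).ne' e1
      linarith

lemma IsChainEigenvector.neg (h : IsChainEigenvector a b m lam u) :
    IsChainEigenvector a b m lam (fun k => -u k) := by
  refine ⟨by simp [h.1], fun w hw => ?_⟩
  have e1 : chainForm a m (fun k => -u k) w = -chainForm a m u w := by
    rw [chainForm, chainForm, ← Finset.sum_neg_distrib]
    exact Finset.sum_congr rfl fun k _ => by ring
  have e2 : massForm b m (fun k => -u k) w = -massForm b m u w := by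
    rw [massForm, massForm, ← Finset.sum_neg_distrib]
    exact Finset.sum_congr rfl fun k _ => by ring
  rw [e1, e2, h.2 w hw]; ring

/-- The mass is diagonal, so it does not see signs, and `||x| - |y|| ≤ |x - y|` shows that the
energy does not grow. Thus `|u|` is again a minimizer. -/
lemma IsChainEigenvector.abs (ha : ∀ k < m, 0 < a k) (hmin : IsRayleighBound a b m lam)
    (h : IsChainEigenvector a b m lam u) : IsChainEigenvector a b m lam (fun k => |u k|) := by
  refine hmin.isChainEigenvector (by simp [h.1]) ?_
  have e : massForm b m (fun k => |u k|) (fun k => |u k|) = massForm b m u u :=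
    Finset.sum_congr rfl fun k _ => by rw [abs_mul_abs_self]
  rw [e, ← h.2 u h.1]
  refine Finset.sum_le_sum fun k hk => mul_le_mul_of_nonneg_left ?_ (ha k (Finset.mem_range.1 hk)).le
  rw [← abs_mul_abs_self (|u (k + 1)| - |u k|), ← abs_mul_abs_self (u (k + 1) - u k)]
  exact mul_self_le_mul_self (abs_nonneg _) (abs_abs_sub_abs_le_abs_sub _ _)

/-- An eigenvector for the smallest eigenvalue has constant sign. -/
lemma IsChainEigenvector.nonneg_or_nonpos (ha : ∀ k < m, 0 < a k)
    (hmin : IsRayleighBound a b m lam) (h : IsChainEigenvector a b m lam u) :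
    (∀ k ≤ m, 0 ≤ u k) ∨ (∀ k ≤ m, u k ≤ 0) := by
  rcases le_total 0 (u 0) with h0 | h0
  · refine Or.inl fun k hk => ?_
    rw [h.ext ha (h.abs ha hmin) (abs_of_nonneg h0).symm k hk]
    exact abs_nonneg _
  · refine Or.inr fun k hk => ?_
    have := h.neg.ext ha (h.abs ha hmin) (abs_of_nonpos h0).symm k hk
    have := abs_nonneg (u k)
    linarith

/-- Zero energy would make the sequence constant, hence zero by the condition at `m`. -/
lemma chainForm_self_pos (ha : ∀ k < m, 0 < a k) (hu0 : u m = 0) (hu : ∃ i < m, u i ≠ 0) :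
    0 < chainForm a m u u := by
  by_contra hle
  have hnn : ∀ k ∈ Finset.range m, 0 ≤ a k * ((u (k + 1) - u k) * (u (k + 1) - u k)) :=
    fun k hk => mul_nonneg (ha k (Finset.mem_range.1 hk)).le (mul_self_nonneg _)
  have h0 := (Finset.sum_eq_zero_iff_of_nonneg hnn).1
    (le_antisymm (not_lt.1 hle) (Finset.sum_nonneg hnn))
  obtain ⟨i, hi, hne⟩ := hu
  have hconst : ∀ k ≤ m, u k = u 0 := by
    intro k
    induction k with
    | zero => simp
    | succ k ih =>
      intro hk
      have := h0 k (Finset.mem_range.2 hk)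
      rw [mul_eq_zero, mul_self_eq_zero] at this
      have := this.resolve_left (ha k hk).ne'
      linarith [ih (by omega)]
  exact hne (by rw [hconst i hi.le, ← hconst m le_rfl, hu0])

end Chain

/-! ### Partitions and piecewise affine functions -/

namespace Mesh

variable {M : Mesh} {N : ℕ} {v χ : ℝ → ℝ}

lemma step_pos {k : ℕ} (hk : k < M.m) : 0 < M.step k := sub_pos.2 (M.node_lt k hk)

lemma step_le_h {k : ℕ} (hk : k < M.m) : M.step k ≤ M.h :=
  Finset.le_sup' M.step (Finset.mem_range.2 hk)

lemma h_nonneg : 0 ≤ M.h := (step_pos M.m_pos).le.trans (step_le_h M.m_pos)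

lemma node_mono {i j : ℕ} (hij : i ≤ j) (hj : j ≤ M.m) : M.node i ≤ M.node j := by
  induction j, hij using Nat.le_induction with
  | base => exact le_rfl
  | succ j _ ih => exact (ih (by omega)).trans (M.node_lt j hj).le

lemma node_nonneg {k : ℕ} (hk : k ≤ M.m) : 0 ≤ M.node k :=
  M.node_zero ▸ node_mono (Nat.zero_le k) hk

lemma node_le_one {k : ℕ} (hk : k ≤ M.m) : M.node k ≤ 1 :=
  M.node_last ▸ node_mono hk le_rfl

lemma node_mem {k : ℕ} (hk : k ≤ M.m) : M.node k ∈ Set.Icc (0 : ℝ) 1 :=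
  ⟨node_nonneg hk, node_le_one hk⟩

lemma Icc_elem_subset {k : ℕ} (hk : k < M.m) :
    Set.Icc (M.node k) (M.node (k + 1)) ⊆ Set.Icc 0 1 :=
  Set.Icc_subset_Icc (node_nonneg hk.le) (node_le_one hk)

lemma exists_mem_Icc_elem_of_le {x : ℝ} (hx : 0 ≤ x) {j : ℕ} (hj : 0 < j) (hjm : j ≤ M.m)
    (hxj : x ≤ M.node j) : ∃ k < j, x ∈ Set.Icc (M.node k) (M.node (k + 1)) := by
  induction j with
  | zero => omega
  | succ j ih =>
    rcases le_or_gt (M.node j) x with h | h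
    · exact ⟨j, j.lt_succ_self, h, hxj⟩
    · rcases Nat.eq_zero_or_pos j with rfl | h0
      · rw [M.node_zero] at h; linarith
      · obtain ⟨k, hk, hk'⟩ := ih h0 (by omega) h.le
        exact ⟨k, by omega, hk'⟩

lemma exists_mem_Icc_elem {x : ℝ} (hx : x ∈ Set.Icc (0 : ℝ) 1) :
    ∃ k < M.m, x ∈ Set.Icc (M.node k) (M.node (k + 1)) :=
  exists_mem_Icc_elem_of_le hx.1 M.m_pos le_rfl (by rw [M.node_last]; exact hx.2)

/-- Almost every point of `[0, 1]` lies inside an element. -/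
lemma ae_mem_Ioo_elem (M : Mesh) : ∀ᵐ x : ℝ, x ∈ Set.Icc (0 : ℝ) 1 →
    ∃ k < M.m, x ∈ Set.Ioo (M.node k) (M.node (k + 1)) := by
  have : ∀ᵐ x : ℝ, ∀ k : ℕ, x ≠ M.node k := ae_all_iff.2 fun k => Measure.ae_ne _ _
  filter_upwards [this] with x hx hx01
  obtain ⟨k, hk, h⟩ := exists_mem_Icc_elem (M := M) hx01
  exact ⟨k, hk, lt_of_le_of_ne h.1 (hx k).symm, lt_of_le_of_ne h.2 (hx (k + 1))⟩

/-- The slope of `v` on the `k`-th element. -/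
def slope (M : Mesh) (v : ℝ → ℝ) (k : ℕ) : ℝ := (v (M.node (k + 1)) - v (M.node k)) / M.step k

/-- `v` is affine on every closed element. -/
def IsPiecewiseAffine (M : Mesh) (v : ℝ → ℝ) : Prop :=
  ∀ k < M.m, ∀ x ∈ Set.Icc (M.node k) (M.node (k + 1)),
    v x = v (M.node k) + M.slope v k * (x - M.node k)

/-- The affine formula is given on open elements only; continuity carries it to the endpoints, which
fixes its coefficients in terms of nodal values. -/
lemma MemS.isPiecewiseAffine (h : M.MemS v) : M.IsPiecewiseAffine v := by
  intro k hk
  obtain ⟨a, b, hab⟩ := h.2.1 k hk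
  have hlt := M.node_lt k hk
  have hcont : ContinuousOn v (Set.Icc (M.node k) (M.node (k + 1))) := by
    have := h.1.1.continuousOn
    rw [Set.uIcc_of_le zero_le_one] at this
    exact this.mono (Icc_elem_subset hk)
  have hEq : Set.EqOn v (fun x => a + b * x) (Set.Icc (M.node k) (M.node (k + 1))) := by
    have : Set.EqOn v (fun x => a + b * x) (Set.Ioo (M.node k) (M.node (k + 1))) := hab
    refine this.of_subset_closure hcont (by fun_prop) Set.Ioo_subset_Icc_self ?_
    rw [closure_Ioo hlt.ne]
  have e0 := hEq (Set.left_mem_Icc.2 hlt.le)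
  have e1 := hEq (Set.right_mem_Icc.2 hlt.le)
  intro x hx
  have hs : M.slope v k = b := by
    rw [slope, e0, e1, div_eq_iff (step_pos hk).ne', step]; ring
  rw [hs, hEq hx, e0]; ring

lemma IsPiecewiseAffine.lipschitzOnWith (h : M.IsPiecewiseAffine v) :
    ∃ C, LipschitzOnWith C v (Set.Icc 0 1) := by
  -- A crude Lipschitz constant suffices: the sum of all `|slope|`s dominates each of them.
  set C : ℝ := ∑ k ∈ Finset.range M.m, |M.slope v k| with hC
  have hC0 : 0 ≤ C := Finset.sum_nonneg fun _ _ => abs_nonneg _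
  have key : ∀ j ≤ M.m, ∀ x ∈ Set.Icc 0 (M.node j), ∀ y ∈ Set.Icc 0 (M.node j), x ≤ y →
      |v y - v x| ≤ C * (y - x) := by
    intro j
    induction j with
    | zero =>
      intro _ x hx y hy _
      rw [M.node_zero] at hx hy
      have hx' := le_antisymm hx.2 hx.1
      have hy' := le_antisymm hy.2 hy.1
      simp [hx', hy']
    | succ j ih =>
      intro hj x hx y hy hxy
      have hsl : |M.slope v j| ≤ C :=
        Finset.single_le_sum (f := fun k => |M.slope v k|) (fun _ _ => abs_nonneg _)
          (Finset.mem_range.2 hj)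
      have hloc : ∀ s ∈ Set.Icc (M.node j) (M.node (j + 1)),
          ∀ t ∈ Set.Icc (M.node j) (M.node (j + 1)), s ≤ t → |v t - v s| ≤ C * (t - s) := by
        intro s hs t ht hst
        rw [h j hj s hs, h j hj t ht, show v (M.node j) + M.slope v j * (t - M.node j) -
          (v (M.node j) + M.slope v j * (s - M.node j)) = M.slope v j * (t - s) by ring, abs_mul,
          abs_of_nonneg (sub_nonneg.2 hst)]
        exact mul_le_mul_of_nonneg_right hsl (sub_nonneg.2 hst)
      have hj0 := node_nonneg (M := M) (k := j) (by omega)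
      have hlt := M.node_lt j hj
      rcases le_total y (M.node j) with hyj | hyj
      · exact ih (by omega) x ⟨hx.1, hxy.trans hyj⟩ y ⟨hy.1, hyj⟩ hxy
      · rcases le_total x (M.node j) with hxj | hxj
        · have h1 := ih (by omega) x ⟨hx.1, hxj⟩ _ ⟨hj0, le_rfl⟩ hxj
          have h2 := hloc _ ⟨le_rfl, hlt.le⟩ y ⟨hyj, hy.2⟩ hyj
          calc |v y - v x| = |(v y - v (M.node j)) + (v (M.node j) - v x)| := by ring_nf
            _ ≤ _ := abs_add_le _ _
            _ ≤ C * (y - M.node j) + C * (M.node j - x) := add_le_add h2 h1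
            _ = C * (y - x) := by ring
        · exact hloc x ⟨hxj, hx.2⟩ y ⟨hyj, hy.2⟩ hxy
  refine ⟨⟨C, hC0⟩, LipschitzOnWith.of_dist_le_mul fun x hx y hy => ?_⟩
  have hlast := key M.m le_rfl
  rw [M.node_last] at hlast
  rw [Real.dist_eq, Real.dist_eq]
  rcases le_total x y with hxy | hxy
  · rw [abs_sub_comm, abs_sub_comm x y, abs_of_nonneg (sub_nonneg.2 hxy)]
    exact hlast x hx y hy hxy
  · rw [abs_of_nonneg (sub_nonneg.2 hxy)]
    exact hlast y hy x hx hxy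

lemma IsPiecewiseAffine.continuousOn (h : M.IsPiecewiseAffine v) :
    ContinuousOn v (Set.Icc 0 1) :=
  let ⟨_, hC⟩ := h.lipschitzOnWith
  hC.continuousOn

lemma IsPiecewiseAffine.memS (h : M.IsPiecewiseAffine v) (h1 : v 1 = 0) : M.MemS v := by
  obtain ⟨C, hC⟩ := h.lipschitzOnWith
  refine ⟨⟨?_, ?_⟩, fun k hk => ?_, h1⟩
  · rw [← Set.uIcc_of_le zero_le_one] at hC
    exact hC.absolutelyContinuousOnInterval
  · refine MemLp.of_bound (measurable_deriv v).aestronglyMeasurable C ?_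
    refine (ae_restrict_iff' measurableSet_Ioo).2 (.of_forall fun x hx => ?_)
    exact norm_deriv_le_of_lipschitzOn (Icc_mem_nhds hx.1 hx.2) hC
  · refine ⟨v (M.node k) - M.slope v k * M.node k, M.slope v k, fun x hx => ?_⟩
    rw [h k hk x (Set.Ioo_subset_Icc_self hx)]; ring

lemma IsPiecewiseAffine.deriv_eq (h : M.IsPiecewiseAffine v) {k : ℕ} (hk : k < M.m) {x : ℝ}
    (hx : x ∈ Set.Ioo (M.node k) (M.node (k + 1))) : deriv v x = M.slope v k := by
  have : v =ᶠ[nhds x] fun y => v (M.node k) + M.slope v k * (y - M.node k) := by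
    filter_upwards [Ioo_mem_nhds hx.1 hx.2] with y hy
    exact h k hk y (Set.Ioo_subset_Icc_self hy)
  rw [this.deriv_eq]
  simp

/-! ### Element integrals, hat functions and the matrices of the discrete problem -/

/-- Integration element by element. -/
lemma integral_eq_sum_elem {f : ℝ → ℝ}
    (hf : ∀ k < M.m, IntervalIntegrable f volume (M.node k) (M.node (k + 1))) :
    ∫ x in (0 : ℝ)..1, f x = ∑ k ∈ Finset.range M.m, ∫ x in M.node k..M.node (k + 1), f x := by
  rw [intervalIntegral.sum_integral_adjacent_intervals hf, M.node_zero, M.node_last]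

/-- The weighted length of an element. -/
def weight (M : Mesh) (N k : ℕ) : ℝ := ∫ x in M.node k..M.node (k + 1), x ^ (N - 1)

/-- The coupling coefficients of the stiffness matrix. -/
def coupling (M : Mesh) (N k : ℕ) : ℝ := M.weight N k / M.step k ^ 2

/-- The diagonal entries of the lumped mass matrix. -/
def nodalMass (M : Mesh) (N i : ℕ) : ℝ := wInner N (fun _ => 1) (M.hat i)

/-- The contribution of the `k`-th element to the mass at its left endpoint. -/
def leftMass (M : Mesh) (N k : ℕ) : ℝ :=
  ∫ x in M.node k..M.node (k + 1), x ^ (N - 1) * ((M.node (k + 1) - x) / M.step k)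

/-- The contribution of the `k`-th element to the mass at its right endpoint. -/
def rightMass (M : Mesh) (N k : ℕ) : ℝ :=
  ∫ x in M.node k..M.node (k + 1), x ^ (N - 1) * ((x - M.node k) / M.step k)

lemma aForm_eq_chainForm (hv : M.IsPiecewiseAffine v) (hχ : M.IsPiecewiseAffine χ) :
    aForm N v χ = chainForm (M.coupling N) M.m (fun k => v (M.node k)) (fun k => χ (M.node k)) := by
  have hEq : ∀ k < M.m, Set.EqOn (fun x => x ^ (N - 1) * (deriv v x * deriv χ x))
      (fun x => x ^ (N - 1) * (M.slope v k * M.slope χ k))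
      (Set.Ioo (M.node k) (M.node (k + 1))) := fun k hk x hx => by
    simp only [hv.deriv_eq hk hx, hχ.deriv_eq hk hx]
  rw [aForm, integral_eq_sum_elem (M := M)]
  · refine Finset.sum_congr rfl fun k hk => ?_
    have hk' := Finset.mem_range.1 hk
    rw [intervalIntegral.integral_congr_Ioo_of_le (M.node_lt k hk').le (hEq k hk'),
      intervalIntegral.integral_mul_const]
    have := (step_pos hk').ne'
    simp only [slope, coupling, weight]
    field_simp
  · intro k hk
    have : IntervalIntegrable (fun x => x ^ (N - 1) * (M.slope v k * M.slope χ k)) volume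
      (M.node k) (M.node (k + 1)) := Continuous.intervalIntegrable (by fun_prop) _ _
    refine this.congr_uIoo ?_
    rw [Set.uIoo_of_le (M.node_lt k hk).le]
    exact (hEq k hk).symm

lemma lumped_eq_massForm (w v : ℝ → ℝ) : M.lumped N w v =
    massForm (M.nodalMass N) M.m (fun k => w (M.node k)) (fun k => v (M.node k)) := rfl

/-- One formula on the whole closed element; at shared nodes the overlapping cases of `hat` give the
same value. -/
lemma hat_apply {i k : ℕ} (hi : i < M.m) (hk : k < M.m) {x : ℝ}
    (hx : x ∈ Set.Icc (M.node k) (M.node (k + 1))) :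
    M.hat i x = if i = k then (M.node (k + 1) - x) / M.step k
      else if i = k + 1 then (x - M.node k) / M.step k else 0 := by
  have hs := (step_pos hk).ne'
  rw [hat]
  rcases lt_trichotomy i k with h | rfl | h
  · have h1 : M.node (i + 1) ≤ M.node k := node_mono h hk.le
    have h2 := M.node_lt i hi
    have hx1 := hx.1
    rw [if_neg (fun h' => by linarith [h'.2.2]), if_neg h.ne,
      if_neg (show ¬i = k + 1 by omega)]
    split_ifs with h3
    · rw [show x = M.node (i + 1) by linarith [h3.2], sub_self, zero_div]
    · rfl
  · rw [if_pos rfl]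
    split_ifs with h1 h2
    · have hx0 : x = M.node i := le_antisymm h1.2.2 hx.1
      have := M.node_lt (i - 1) (by omega)
      rw [Nat.sub_add_cancel h1.1] at this
      rw [hx0, div_self (sub_pos.2 this).ne', ← step, div_self hs]
    · rfl
    · exact absurd hx h2
  · rw [if_neg h.ne']
    rcases (Nat.succ_le_of_lt h).eq_or_lt with rfl | h'
    · rw [if_pos rfl, if_pos ⟨by omega, hx.1, hx.2⟩]
      rfl
    · rw [if_neg h'.ne']
      have h1 : M.node (k + 1) ≤ M.node (i - 1) := node_mono (by omega) (by omega)
      have h2 := M.node_lt (i - 1) (by omega)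
      rw [Nat.sub_add_cancel (by omega)] at h2
      have hx2 := hx.2
      split_ifs with h3 h4
      · rw [show x = M.node (i - 1) by linarith [h3.2.1], sub_self, zero_div]
      · linarith [h4.1]
      · rfl

/-- The piecewise affine function with nodal values `u` that vanishes at `1`. -/
def interp (M : Mesh) (u : ℕ → ℝ) (x : ℝ) : ℝ := ∑ i ∈ Finset.range M.m, u i * M.hat i x

lemma interp_apply {u : ℕ → ℝ} (hu : u M.m = 0) {k : ℕ} (hk : k < M.m) {x : ℝ}
    (hx : x ∈ Set.Icc (M.node k) (M.node (k + 1))) :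
    M.interp u x = u k * ((M.node (k + 1) - x) / M.step k) +
      u (k + 1) * ((x - M.node k) / M.step k) := by
  have : ∀ i ∈ Finset.range M.m, u i * M.hat i x =
      (if i = k then u k * ((M.node (k + 1) - x) / M.step k) else 0) +
      (if i = k + 1 then u (k + 1) * ((x - M.node k) / M.step k) else 0) := by
    intro i hi
    rw [hat_apply (Finset.mem_range.1 hi) hk hx]
    rcases eq_or_ne i k with rfl | h1
    · simp
    · rcases eq_or_ne i (k + 1) with rfl | h2
      · simp
      · simp [h1, h2]
  rw [interp, Finset.sum_congr rfl this, Finset.sum_add_distrib, Finset.sum_ite_eq',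
    Finset.sum_ite_eq', if_pos (Finset.mem_range.2 hk)]
  split_ifs with h
  · rfl
  · have : k + 1 = M.m := by have := Finset.mem_range.not.1 h; omega
    rw [this, hu, zero_mul]

lemma interp_node {u : ℕ → ℝ} (hu : u M.m = 0) {k : ℕ} (hk : k ≤ M.m) :
    M.interp u (M.node k) = u k := by
  rcases Nat.eq_zero_or_pos k with rfl | h
  · rw [interp_apply hu M.m_pos ⟨le_rfl, (M.node_lt 0 M.m_pos).le⟩, ← step,
      div_self (step_pos M.m_pos).ne', sub_self]
    simp
  · obtain ⟨j, rfl⟩ : ∃ j, k = j + 1 := ⟨k - 1, by omega⟩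
    rw [interp_apply hu hk ⟨(M.node_lt j hk).le, le_rfl⟩, ← step,
      div_self (step_pos hk).ne', sub_self]
    simp

lemma isPiecewiseAffine_interp {u : ℕ → ℝ} (hu : u M.m = 0) : M.IsPiecewiseAffine (M.interp u) := by
  intro k hk x hx
  rw [slope, interp_node hu hk.le, interp_node hu hk, interp_apply hu hk hx]
  have := (step_pos hk).ne'
  field_simp
  rw [step]; ring

lemma memS_interp {u : ℕ → ℝ} (hu : u M.m = 0) : M.MemS (M.interp u) := by
  refine (isPiecewiseAffine_interp hu).memS ?_
  rw [← M.node_last, interp_node hu le_rfl, hu]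

/-- The mass at a node collects half a hat from each adjacent element; the node at the origin has no
left neighbour. -/
lemma nodalMass_eq {i : ℕ} (hi : i < M.m) :
    M.nodalMass N i = M.leftMass N i + if i = 0 then 0 else M.rightMass N (i - 1) := by
  have hEq : ∀ k < M.m, Set.EqOn
      (fun x => x ^ (N - 1) * (if i = k then (M.node (k + 1) - x) / M.step k
        else if i = k + 1 then (x - M.node k) / M.step k else 0))
      (fun x => x ^ (N - 1) * (1 * M.hat i x)) (Set.Icc (M.node k) (M.node (k + 1))) :=
    fun k hk x hx => by simp only [hat_apply hi hk hx, one_mul]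
  have hval : ∀ k < M.m, ∫ x in M.node k..M.node (k + 1), x ^ (N - 1) * (1 * M.hat i x) =
      (if i = k then M.leftMass N k else 0) + (if i = k + 1 then M.rightMass N k else 0) := by
    intro k hk
    have h1 := hEq k hk
    rw [← Set.uIcc_of_le (M.node_lt k hk).le] at h1
    rw [← intervalIntegral.integral_congr h1]
    split_ifs with h1 h2
    · omega
    · rw [add_zero]; rfl
    · rw [zero_add]; rfl
    · simp
  rw [nodalMass, wInner, integral_eq_sum_elem (M := M)]
  · rw [Finset.sum_congr rfl fun k hk => hval k (Finset.mem_range.1 hk), Finset.sum_add_distrib,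
      Finset.sum_ite_eq, if_pos (Finset.mem_range.2 hi)]
    congr 1
    split_ifs with h
    · subst h
      exact Finset.sum_eq_zero fun k _ => if_neg (by omega)
    · rw [Finset.sum_eq_single (i - 1)]
      · rw [if_pos (by omega)]
      · intro k _ hk
        exact if_neg (by omega)
      · intro h'
        exact absurd (Finset.mem_range.2 (by omega)) h'
  · intro k hk
    have hc : IntervalIntegrable (fun x => x ^ (N - 1) *
        (if i = k then (M.node (k + 1) - x) / M.step k
        else if i = k + 1 then (x - M.node k) / M.step k else 0)) volume
        (M.node k) (M.node (k + 1)) := by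
      refine Continuous.intervalIntegrable ?_ _ _
      split_ifs <;> fun_prop
    refine hc.congr_uIoo ?_
    rw [Set.uIoo_of_le (M.node_lt k hk).le]
    exact (hEq k hk).mono Set.Ioo_subset_Icc_self

lemma weight_pos {k : ℕ} (hk : k < M.m) : 0 < M.weight N k := by
  refine intervalIntegral.intervalIntegral_pos_of_pos_on
    (Continuous.intervalIntegrable (by fun_prop) _ _) (fun x hx => ?_) (M.node_lt k hk)
  exact pow_pos ((node_nonneg hk.le).trans_lt hx.1) _

lemma coupling_pos {k : ℕ} (hk : k < M.m) : 0 < M.coupling N k :=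
  div_pos (weight_pos hk) (pow_pos (step_pos hk) 2)

lemma leftMass_pos {k : ℕ} (hk : k < M.m) : 0 < M.leftMass N k := by
  refine intervalIntegral.intervalIntegral_pos_of_pos_on
    (Continuous.intervalIntegrable (by fun_prop) _ _) (fun x hx => ?_) (M.node_lt k hk)
  exact mul_pos (pow_pos ((node_nonneg hk.le).trans_lt hx.1) _)
    (div_pos (sub_pos.2 hx.2) (step_pos hk))

lemma rightMass_pos {k : ℕ} (hk : k < M.m) : 0 < M.rightMass N k := by
  refine intervalIntegral.intervalIntegral_pos_of_pos_on
    (Continuous.intervalIntegrable (by fun_prop) _ _) (fun x hx => ?_) (M.node_lt k hk)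
  exact mul_pos (pow_pos ((node_nonneg hk.le).trans_lt hx.1) _)
    (div_pos (sub_pos.2 hx.1) (step_pos hk))

lemma leftMass_add_rightMass {k : ℕ} (hk : k < M.m) :
    M.leftMass N k + M.rightMass N k = M.weight N k := by
  have := (step_pos hk).ne'
  rw [leftMass, rightMass, weight, ← intervalIntegral.integral_add
    (Continuous.intervalIntegrable (by fun_prop) _ _)
    (Continuous.intervalIntegrable (by fun_prop) _ _)]
  refine intervalIntegral.integral_congr fun x _ => ?_
  field_simp
  rw [step]; ring

lemma nodalMass_pos {i : ℕ} (hi : i < M.m) : 0 < M.nodalMass N i := by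
  rw [nodalMass_eq hi]
  refine add_pos_of_pos_of_nonneg (leftMass_pos hi) ?_
  split_ifs with h
  exacts [le_rfl, (rightMass_pos (by omega)).le]

lemma IsPiecewiseAffine.integral_elem (hv : M.IsPiecewiseAffine v) {k : ℕ} (hk : k < M.m) :
    ∫ x in M.node k..M.node (k + 1), x ^ (N - 1) * v x =
      v (M.node k) * M.leftMass N k + v (M.node (k + 1)) * M.rightMass N k := by
  have := (step_pos hk).ne'
  rw [leftMass, rightMass, ← intervalIntegral.integral_const_mul,
    ← intervalIntegral.integral_const_mul, ← intervalIntegral.integral_add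
    (Continuous.intervalIntegrable (by fun_prop) _ _)
    (Continuous.intervalIntegrable (by fun_prop) _ _)]
  refine intervalIntegral.integral_congr fun x hx => ?_
  rw [Set.uIcc_of_le (M.node_lt k hk).le] at hx
  rw [hv k hk x hx, slope]
  field_simp
  rw [step]; ring

lemma intervalIntegrable_pow_mul {v : ℝ → ℝ} (hv : ContinuousOn v (Set.Icc 0 1)) (n : ℕ) {a b : ℝ}
    (ha : a ∈ Set.Icc (0 : ℝ) 1) (hb : b ∈ Set.Icc (0 : ℝ) 1) :
    IntervalIntegrable (fun x => x ^ n * v x) volume a b := by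
  refine ContinuousOn.intervalIntegrable ?_
  refine ContinuousOn.mul (by fun_prop) (hv.mono ?_)
  rw [← Set.uIcc_of_le zero_le_one] at *
  exact Set.uIcc_subset_uIcc ha hb

/-- The partial lumped masses are exact integrals up to the left endpoint of an element. -/
lemma IsPiecewiseAffine.sum_nodalMass (hv : M.IsPiecewiseAffine v) {k : ℕ} (hk : k < M.m) :
    ∑ i ∈ Finset.range (k + 1), v (M.node i) * M.nodalMass N i =
      (∫ x in (0 : ℝ)..M.node k, x ^ (N - 1) * v x) + v (M.node k) * M.leftMass N k := by
  induction k with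
  | zero => simp [nodalMass_eq hk, M.node_zero]
  | succ k ih =>
    have hk' : k < M.m := by omega
    rw [Finset.sum_range_succ, ih hk', nodalMass_eq hk, if_neg (by omega), Nat.add_sub_cancel,
      ← intervalIntegral.integral_add_adjacent_intervals
        (intervalIntegrable_pow_mul hv.continuousOn _
          (Set.left_mem_Icc.2 zero_le_one) (node_mem hk'.le))
        (intervalIntegrable_pow_mul hv.continuousOn _ (node_mem hk'.le) (node_mem (k := k + 1) hk.le)),
      hv.integral_elem hk']
    ring

end Mesh

lemma chainForm_congr_right {a : ℕ → ℝ} {m : ℕ} {u w w' : ℕ → ℝ} (h : ∀ k ≤ m, w k = w' k) :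
    chainForm a m u w = chainForm a m u w' := by
  refine Finset.sum_congr rfl fun k hk => ?_
  have := Finset.mem_range.1 hk
  rw [h k (by omega), h (k + 1) (by omega)]

lemma massForm_congr_right {b : ℕ → ℝ} {m : ℕ} {u w w' : ℕ → ℝ} (h : ∀ k < m, w k = w' k) :
    massForm b m u w = massForm b m u w' := by
  refine Finset.sum_congr rfl fun k hk => ?_
  rw [h k (Finset.mem_range.1 hk)]

lemma chainForm_comm (a : ℕ → ℝ) (m : ℕ) (u w : ℕ → ℝ) :
    chainForm a m u w = chainForm a m w u :=
  Finset.sum_congr rfl fun k _ => by ring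

lemma massForm_comm (b : ℕ → ℝ) (m : ℕ) (u w : ℕ → ℝ) :
    massForm b m u w = massForm b m w u :=
  Finset.sum_congr rfl fun k _ => by ring

/-! ### The lumped problem as a chain problem -/

namespace Mesh

variable {M : Mesh} {N : ℕ} {lam : ℝ} {v : ℝ → ℝ}

lemma IsEigenfunction.isPiecewiseAffine (h : M.IsEigenfunction N lam v) : M.IsPiecewiseAffine v :=
  h.1.isPiecewiseAffine

/-- Every sequence vanishing at `M.m` is the nodal trace of a test function, namely its interpolant.
-/
lemma IsEigenfunction.isChainEigenvector (h : M.IsEigenfunction N lam v) :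
    IsChainEigenvector (M.coupling N) (M.nodalMass N) M.m lam (fun k => v (M.node k)) := by
  refine ⟨by simpa only [M.node_last] using h.1.2.2, fun w hw => ?_⟩
  have := h.2.2 _ (memS_interp hw)
  rw [aForm_eq_chainForm h.isPiecewiseAffine (isPiecewiseAffine_interp hw),
    lumped_eq_massForm] at this
  rwa [chainForm_congr_right (w' := w) fun k hk => interp_node hw hk,
    massForm_congr_right (w' := w) fun k hk => interp_node hw hk.le] at this

lemma isEigenfunction_interp {u : ℕ → ℝ}
    (h : IsChainEigenvector (M.coupling N) (M.nodalMass N) M.m lam u) (hu : ∃ i < M.m, u i ≠ 0) :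
    M.IsEigenfunction N lam (M.interp u) := by
  obtain ⟨i, hi, hne⟩ := hu
  refine ⟨memS_interp h.1, ⟨M.node i, node_mem hi.le, by rwa [interp_node h.1 hi.le]⟩,
    fun χ hχ => ?_⟩
  rw [aForm_eq_chainForm (isPiecewiseAffine_interp h.1) hχ.isPiecewiseAffine, lumped_eq_massForm,
    chainForm_comm, massForm_comm,
    chainForm_congr_right (w' := u) fun k hk => interp_node h.1 hk,
    massForm_congr_right (w' := u) fun k hk => interp_node h.1 hk.le,
    chainForm_comm, massForm_comm]
  exact h.2 _ (by simpa only [M.node_last] using hχ.2.2)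

lemma IsEigenfunction.exists_node_ne_zero (h : M.IsEigenfunction N lam v) :
    ∃ i < M.m, v (M.node i) ≠ 0 := by
  by_contra! h0
  have h0' : ∀ k ≤ M.m, v (M.node k) = 0 := fun k hk => by
    rcases hk.lt_or_eq with h' | rfl
    · exact h0 k h'
    · rw [M.node_last]; exact h.1.2.2
  obtain ⟨x, hx, hne⟩ := h.2.1
  obtain ⟨k, hk, hxk⟩ := exists_mem_Icc_elem (M := M) hx
  refine hne ?_
  rw [h.isPiecewiseAffine k hk x hxk, slope, h0' k hk.le, h0' (k + 1) hk]
  simp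

/-- The lumped problem has a smallest eigenvalue; it is positive and minimizes the Rayleigh
quotient. -/
lemma exists_isLeast_eigenvalues (M : Mesh) (N : ℕ) : ∃ lam : ℝ, 0 < lam ∧
    IsLeast (M.eigenvalues N) lam ∧ IsRayleighBound (M.coupling N) (M.nodalMass N) M.m lam := by
  have hb : ∀ i < M.m, 0 < M.nodalMass N i := fun i hi => nodalMass_pos hi
  obtain ⟨u, hu0, hu1, hmin⟩ := exists_rayleigh_min (M.coupling N) M.m_pos hb
  have hne : ∃ i < M.m, u i ≠ 0 := by
    by_contra! h0
    have : massForm (M.nodalMass N) M.m u u = 0 := Finset.sum_eq_zero fun i hi => by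
      simp [h0 i (Finset.mem_range.1 hi)]
    linarith
  refine ⟨_, chainForm_self_pos (fun k hk => coupling_pos (N := N) hk) hu0 hne, ⟨?_, ?_⟩, hmin⟩
  · exact ⟨_, isEigenfunction_interp (hmin.isChainEigenvector hu0 (by rw [hu1, mul_one])) hne⟩
  · rintro lam' ⟨v, hv⟩
    have hev := hv.isChainEigenvector
    have h1 := hmin (fun k => v (M.node k)) hev.1
    rw [hev.2 _ hev.1] at h1
    exact le_of_mul_le_mul_right h1 (massForm_self_pos hb hv.exists_node_ne_zero)

lemma isRayleighBound_of_isLeast (h : IsLeast (M.eigenvalues N) lam) :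
    IsRayleighBound (M.coupling N) (M.nodalMass N) M.m lam := by
  obtain ⟨lam', _, h1, h2⟩ := exists_isLeast_eigenvalues M N
  rwa [h.unique h1]

lemma pos_of_isLeast (h : IsLeast (M.eigenvalues N) lam) : 0 < lam := by
  obtain ⟨lam', h0, h1, _⟩ := exists_isLeast_eigenvalues M N
  rwa [h.unique h1]

lemma IsPiecewiseAffine.nonneg (hv : M.IsPiecewiseAffine v)
    (h : ∀ k ≤ M.m, 0 ≤ v (M.node k)) : ∀ x ∈ Set.Icc (0 : ℝ) 1, 0 ≤ v x := by
  intro x hx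
  obtain ⟨k, hk, hxk⟩ := exists_mem_Icc_elem (M := M) hx
  have hs := step_pos hk
  have e : v x = v (M.node k) * ((M.node (k + 1) - x) / M.step k) +
      v (M.node (k + 1)) * ((x - M.node k) / M.step k) := by
    rw [hv k hk x hxk, slope]
    have := hs.ne'
    field_simp
    rw [step]; ring
  rw [e]
  exact add_nonneg (mul_nonneg (h k hk.le) (div_nonneg (sub_nonneg.2 hxk.2) hs.le))
    (mul_nonneg (h (k + 1) hk) (div_nonneg (sub_nonneg.2 hxk.1) hs.le))

lemma IsPiecewiseAffine.affine_comp (hv : M.IsPiecewiseAffine v) (c d : ℝ) :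
    M.IsPiecewiseAffine (fun x => c * v x + d) := by
  intro k hk x hx
  simp only [slope]
  rw [hv k hk x hx, slope]
  ring

/-- First eigenfunctions of the lumped problem have constant sign. -/
lemma IsEigenfunction.nonneg_or_nonpos (hl : IsLeast (M.eigenvalues N) lam)
    (h : M.IsEigenfunction N lam v) :
    (∀ x ∈ Set.Icc (0 : ℝ) 1, 0 ≤ v x) ∨ (∀ x ∈ Set.Icc (0 : ℝ) 1, v x ≤ 0) := by
  rcases h.isChainEigenvector.nonneg_or_nonpos (fun k hk => coupling_pos hk)
    (isRayleighBound_of_isLeast hl) with h' | h'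
  · exact Or.inl (h.isPiecewiseAffine.nonneg h')
  · refine Or.inr fun x hx => ?_
    have := (h.isPiecewiseAffine.affine_comp (-1) 0).nonneg
      (fun k hk => by linarith [h' k hk]) x hx
    linarith

lemma isPiecewiseAffine_affine (M : Mesh) (c d : ℝ) : M.IsPiecewiseAffine (fun x => c * x + d) := by
  intro k hk x _
  have := (step_pos hk).ne'
  simp only [slope]
  field_simp
  rw [step]; ring

/-- Lumping is exact on piecewise affine functions except that the node `1` carries no mass; the
subtracted term is its missing half hat. -/
lemma IsPiecewiseAffine.sum_nodalMass_range (hv : M.IsPiecewiseAffine v) :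
    ∑ i ∈ Finset.range M.m, v (M.node i) * M.nodalMass N i =
      (∫ x in (0 : ℝ)..1, x ^ (N - 1) * v x) - v 1 * M.rightMass N (M.m - 1) := by
  have hm := M.m_pos
  have hm1 : M.m - 1 + 1 = M.m := by omega
  have h1 := hv.sum_nodalMass (N := N) (show M.m - 1 < M.m by omega)
  have h2 := hv.integral_elem (N := N) (show M.m - 1 < M.m by omega)
  rw [hm1] at h1
  rw [hm1, M.node_last] at h2
  have h3 := intervalIntegral.integral_add_adjacent_intervals
    (intervalIntegrable_pow_mul hv.continuousOn (N - 1) (Set.left_mem_Icc.2 zero_le_one)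
      (node_mem (M := M) (k := M.m - 1) (by omega)))
    (intervalIntegrable_pow_mul hv.continuousOn (N - 1)
      (node_mem (M := M) (k := M.m - 1) (by omega)) (Set.right_mem_Icc.2 zero_le_one))
  rw [h1, ← h3, h2]
  ring

/-- A bound of the smallest eigenvalue that does not depend on the mesh. -/
lemma le_of_isLeast (hN : 1 ≤ N) (h : IsLeast (M.eigenvalues N) lam) : lam ≤ (N + 1 : ℝ) ^ 2 := by
  have hlam := pos_of_isLeast h
  -- The test function is `1 - x`, which lies in every `S_h` and has energy `1 / N`.
  have hb := isRayleighBound_of_isLeast h (fun k => -1 * M.node k + 1) (by simp [M.node_last])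
  have hpa := isPiecewiseAffine_affine M (-1) 1
  have hA : chainForm (M.coupling N) M.m (fun k => -1 * M.node k + 1)
      (fun k => -1 * M.node k + 1) = 1 / (N : ℝ) := by
    have := aForm_eq_chainForm (N := N) hpa hpa
    rw [← this, aForm]
    have hd : ∀ x : ℝ, deriv (fun x : ℝ => -1 * x + 1) x = -1 := fun x => by simp
    simp only [hd]
    norm_num [integral_pow, Nat.cast_sub hN]
  have hM1 : ∑ i ∈ Finset.range M.m, (-1 * M.node i + 1) * M.nodalMass N i =
      1 / ((N : ℝ) * (N + 1)) := by
    rw [hpa.sum_nodalMass_range]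
    have e : ∀ x : ℝ, x ^ (N - 1) * (-1 * x + 1) = x ^ (N - 1) - x ^ N := fun x => by
      conv_rhs => rw [← Nat.sub_add_cancel hN, pow_succ]
      simp only [Nat.add_sub_cancel]
      ring
    simp only [e]
    rw [intervalIntegral.integral_sub (Continuous.intervalIntegrable (by fun_prop) _ _)
      (Continuous.intervalIntegrable (by fun_prop) _ _), integral_pow, integral_pow,
      Nat.sub_add_cancel hN]
    have : (N : ℝ) ≠ 0 := by positivity
    rw [Nat.cast_sub hN, zero_pow (by omega), zero_pow (by omega)]
    push_cast
    rw [sub_add_cancel]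
    field_simp
    simp
  have hM0 : ∑ i ∈ Finset.range M.m, M.nodalMass N i ≤ 1 / (N : ℝ) := by
    have h1 := (isPiecewiseAffine_affine M 0 1).sum_nodalMass_range (N := N)
    simp only [zero_mul, zero_add, one_mul, mul_one] at h1
    rw [h1, integral_pow]
    have := rightMass_pos (N := N) (show M.m - 1 < M.m by have := M.m_pos; omega)
    rw [one_pow, zero_pow (by omega), Nat.cast_sub hN]
    push_cast
    simp only [sub_add_cancel, sub_zero]
    linarith
  have hN0 : (0 : ℝ) < N := by exact_mod_cast hN
  have hB : 1 / ((N : ℝ) * (N + 1) ^ 2) ≤ massForm (M.nodalMass N) M.m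
      (fun k => -1 * M.node k + 1) (fun k => -1 * M.node k + 1) := by
    -- The lumped square is bounded below through `t ^ 2 ≥ 2 c t - c ^ 2`, which is linear in `t`
    -- and hence summable exactly. The best `c` is the mean of `1 - x` for the weight `N x^(N-1)`.
    set c : ℝ := 1 / (N + 1) with hc
    have hle : ∀ i ∈ Finset.range M.m,
        2 * c * ((-1 * M.node i + 1) * M.nodalMass N i) - c ^ 2 * M.nodalMass N i ≤
        (-1 * M.node i + 1) * (-1 * M.node i + 1) * M.nodalMass N i := fun i hi => by
      nlinarith [mul_nonneg (sq_nonneg ((-1 * M.node i + 1) - c))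
        (nodalMass_pos (N := N) (Finset.mem_range.1 hi)).le]
    refine le_trans ?_ (Finset.sum_le_sum hle)
    rw [Finset.sum_sub_distrib, ← Finset.mul_sum, ← Finset.mul_sum, hM1]
    have : c ^ 2 * ∑ i ∈ Finset.range M.m, M.nodalMass N i ≤ c ^ 2 * (1 / N) := by gcongr
    refine le_trans (le_of_eq ?_) (sub_le_sub_left this _)
    rw [hc]
    field_simp
    ring
  rw [hA] at hb
  have h3 := (mul_le_mul_of_nonneg_left hB hlam.le).trans hb
  rw [mul_one_div, div_le_div_iff₀ (by positivity) hN0] at h3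
  have : lam * N ≤ (N + 1) ^ 2 * N := by linarith
  exact le_of_mul_le_mul_right this hN0

end Mesh

/-! ### The flux and the consistency of the discrete equation -/

/-- The flux `y^(1-N) ∫₀^y x^(N-1) v dx`; a solution `v` of the eigenvalue equation satisfies
`v' = -λ * flux v`. -/
def flux (N : ℕ) (v : ℝ → ℝ) (y : ℝ) : ℝ := (∫ x in (0 : ℝ)..y, x ^ (N - 1) * v x) / y ^ (N - 1)

lemma integral_pow_mul_le {N : ℕ} {v : ℝ → ℝ} {V y : ℝ} (hN : 1 ≤ N) (hy : y ∈ Set.Icc (0 : ℝ) 1) (hV : ∀ x ∈ Set.Icc 0 y, |v x| ≤ V) :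
    |∫ x in (0 : ℝ)..y, x ^ (N - 1) * v x| ≤ V * (y ^ N / N) := by
  have h := intervalIntegral.norm_integral_le_of_norm_le hy.1
    (f := fun x => x ^ (N - 1) * v x) (g := fun x => x ^ (N - 1) * V) (μ := volume)
    (.of_forall fun x hx => ?_) (Continuous.intervalIntegrable (by fun_prop) _ _)
  · rw [intervalIntegral.integral_mul_const, integral_pow, Nat.sub_add_cancel hN,
      zero_pow (by omega), Nat.cast_sub hN] at h
    rw [Real.norm_eq_abs] at h
    refine h.trans (le_of_eq ?_)
    push_cast
    rw [sub_add_cancel, sub_zero]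
    ring
  · rw [Real.norm_eq_abs, abs_mul, abs_of_nonneg (pow_nonneg hx.1.le _)]
    exact mul_le_mul_of_nonneg_left (hV x ⟨hx.1.le, hx.2⟩) (pow_nonneg hx.1.le _)

/-- The singular factor `y^(1-N)` is harmless: it leaves `V * y / N ≤ V`. -/
lemma abs_flux_le {N : ℕ} {v : ℝ → ℝ} {V y : ℝ} (hN : 1 ≤ N) (hy : y ∈ Set.Ioc (0 : ℝ) 1) (hV : ∀ x ∈ Set.Icc 0 y, |v x| ≤ V) :
    |flux N v y| ≤ V := by
  have h := integral_pow_mul_le hN ⟨hy.1.le, hy.2⟩ hV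
  have hV0 : 0 ≤ V := (abs_nonneg _).trans (hV 0 ⟨le_rfl, hy.1.le⟩)
  have hN' : (1 : ℝ) ≤ N := by exact_mod_cast hN
  have hyp : 0 < y ^ (N - 1) := pow_pos hy.1 _
  rw [flux, abs_div, abs_of_pos hyp, div_le_iff₀ hyp]
  refine h.trans (mul_le_mul_of_nonneg_left ?_ hV0)
  rw [div_le_iff₀ (by linarith)]
  have : y ^ N = y ^ (N - 1) * y := by rw [← pow_succ, Nat.sub_add_cancel hN]
  rw [this]
  exact mul_le_mul_of_nonneg_left (hy.2.trans hN') hyp.le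

/-- A mean value bound multiplied by `X`, so that the same power stands on the right and the
estimate survives at the origin. -/
lemma mul_pow_sub_pow_le {x X : ℝ} (hx : 0 ≤ x) (hxX : x ≤ X) (n : ℕ) :
    X * (X ^ n - x ^ n) ≤ n * (X - x) * X ^ n := by
  have hX := hx.trans hxX
  induction n with
  | zero => simp
  | succ n ih =>
    have h1 : x ^ n * (X - x) ≤ X ^ n * (X - x) :=
      mul_le_mul_of_nonneg_right (pow_le_pow_left₀ hx hxX n) (sub_nonneg.2 hxX)
    calc X * (X ^ (n + 1) - x ^ (n + 1))
        = X * (X * (X ^ n - x ^ n) + x ^ n * (X - x)) := by ring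
      _ ≤ X * (n * (X - x) * X ^ n + X ^ n * (X - x)) :=
          mul_le_mul_of_nonneg_left (add_le_add ih h1) hX
      _ = _ := by push_cast; ring

namespace Mesh

variable {M : Mesh} {N : ℕ} {lam : ℝ} {v : ℝ → ℝ}

lemma weight_eq (hN : 1 ≤ N) (k : ℕ) :
    M.weight N k = (M.node (k + 1) ^ N - M.node k ^ N) / N := by
  rw [weight, integral_pow, Nat.sub_add_cancel hN, Nat.cast_sub hN]
  push_cast
  rw [sub_add_cancel]

/-- The weight of an element is comparable to its value at the right endpoint, even on the first
element, where `x^(N-1)` may vanish at the left. -/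
lemma step_mul_pow_le_weight (hN : 1 ≤ N) {k : ℕ} (hk : k < M.m) :
    M.step k * M.node (k + 1) ^ (N - 1) ≤ N * M.weight N k := by
  have hN' : (0 : ℝ) < N := by exact_mod_cast hN
  rw [weight_eq hN, mul_div_cancel₀ _ hN'.ne', step]
  have h0 := node_nonneg hk.le
  have : M.node k ^ (N - 1) ≤ M.node (k + 1) ^ (N - 1) :=
    pow_le_pow_left₀ h0 (M.node_lt k hk).le _
  have e : ∀ x : ℝ, x ^ N = x * x ^ (N - 1) := fun x => by rw [← pow_succ', Nat.sub_add_cancel hN]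
  rw [e, e]
  nlinarith

lemma weight_le {k : ℕ} (hk : k < M.m) : M.weight N k ≤ M.step k * M.node (k + 1) ^ (N - 1) := by
  have hlt := (M.node_lt k hk).le
  have := intervalIntegral.integral_mono_on (μ := volume) hlt
    (f := fun x => x ^ (N - 1)) (g := fun _ => M.node (k + 1) ^ (N - 1))
    (Continuous.intervalIntegrable (by fun_prop) _ _)
    (Continuous.intervalIntegrable (by fun_prop) _ _)
    (fun x hx => pow_le_pow_left₀ ((node_nonneg hk.le).trans hx.1) hx.2 _)
  rw [intervalIntegral.integral_const, smul_eq_mul] at this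
  exact this

lemma le_weight {k : ℕ} (hk : k < M.m) : M.step k * M.node k ^ (N - 1) ≤ M.weight N k := by
  have hlt := (M.node_lt k hk).le
  have := intervalIntegral.integral_mono_on (μ := volume) hlt
    (f := fun _ => M.node k ^ (N - 1)) (g := fun x => x ^ (N - 1))
    (Continuous.intervalIntegrable (by fun_prop) _ _)
    (Continuous.intervalIntegrable (by fun_prop) _ _)
    (fun x hx => pow_le_pow_left₀ (node_nonneg hk.le) hx.1 _)
  rw [intervalIntegral.integral_const, smul_eq_mul] at this
  exact this

/-- The discrete counterpart of `v' = -lam * flux v`: the flux identity of the chain, with its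
partial sum evaluated exactly. -/
lemma IsEigenfunction.slope_eq (h : M.IsEigenfunction N lam v) {k : ℕ} (hk : k < M.m) :
    M.slope v k = -lam * (M.step k / M.weight N k *
      ((∫ x in (0 : ℝ)..M.node k, x ^ (N - 1) * v x) + v (M.node k) * M.leftMass N k)) := by
  have h1 := h.isChainEigenvector.flux hk
  rw [h.isPiecewiseAffine.sum_nodalMass hk] at h1
  have hs := (step_pos hk).ne'
  have hw := (weight_pos (N := N) hk).ne'
  rw [coupling] at h1
  rw [slope, show -lam * (M.step k / M.weight N k *
      ((∫ x in (0 : ℝ)..M.node k, x ^ (N - 1) * v x) + v (M.node k) * M.leftMass N k)) =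
      -(M.step k / M.weight N k) * (lam *
      ((∫ x in (0 : ℝ)..M.node k, x ^ (N - 1) * v x) + v (M.node k) * M.leftMass N k)) by ring, ← h1]
  field_simp
  ring

/-- Nonnegative discrete eigenfunctions are largest at the origin. -/
lemma IsEigenfunction.le_apply_zero (h : M.IsEigenfunction N lam v) (hlam : 0 ≤ lam)
    (hv : ∀ x ∈ Set.Icc (0 : ℝ) 1, 0 ≤ v x) : ∀ x ∈ Set.Icc (0 : ℝ) 1, v x ≤ v 0 := by
  have hnode : ∀ k ≤ M.m, v (M.node k) ≤ v 0 := by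
    intro k
    induction k with
    | zero => intro _; rw [M.node_zero]
    | succ k ih =>
      intro hk
      refine le_trans ?_ (ih (by omega))
      have hs : M.slope v k ≤ 0 := by
        rw [h.slope_eq hk, neg_mul, neg_nonpos]
        refine mul_nonneg hlam (mul_nonneg (div_nonneg (step_pos hk).le (weight_pos hk).le)
          (add_nonneg ?_ (mul_nonneg (hv _ (node_mem (Nat.le_of_lt hk))) (leftMass_pos hk).le)))
        have hk' := node_mem (M := M) (Nat.le_of_lt hk)
        exact intervalIntegral.integral_nonneg hk'.1 fun x hx =>
          mul_nonneg (pow_nonneg hx.1 _) (hv x ⟨hx.1, hx.2.trans hk'.2⟩)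
      rw [slope, div_nonpos_iff] at hs
      have := step_pos (M := M) hk
      rcases hs with hs | hs
      · linarith
      · linarith
  intro x hx
  have := (h.isPiecewiseAffine.affine_comp (-1) (v 0)).nonneg
    (fun k hk => by linarith [hnode k hk]) x hx
  linarith

/-- The discrete eigenfunction satisfies the differential equation up to `O(h)`. -/
lemma IsEigenfunction.abs_slope_add_flux_le (h : M.IsEigenfunction N lam v) (hN : 1 ≤ N)
    (hlam : 0 ≤ lam) (hv : ∀ x ∈ Set.Icc (0 : ℝ) 1, 0 ≤ v x) {k : ℕ} (hk : k < M.m) {y : ℝ}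
    (hy : y ∈ Set.Ioo (M.node k) (M.node (k + 1))) :
    |M.slope v k + lam * flux N v y| ≤ lam * (N * M.h * v 0) := by
  have hle := h.le_apply_zero hlam hv
  have hcont := h.isPiecewiseAffine.continuousOn
  have hx0 := node_nonneg hk.le
  have hX1 := node_le_one (M := M) (k := k + 1) hk
  have hy0 : 0 < y := hx0.trans_lt hy.1
  have hy01 : y ∈ Set.Icc (0 : ℝ) 1 := ⟨hy0.le, hy.2.le.trans hX1⟩
  have hV0 : 0 ≤ v 0 := hv 0 ⟨le_rfl, zero_le_one⟩
  have hN0 : (0 : ℝ) < N := by exact_mod_cast hN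
  have hs := step_pos hk
  have hW := weight_pos (N := N) hk
  have hyn : 0 < y ^ (N - 1) := pow_pos hy0 _
  set X := M.node (k + 1) with hXdef
  set x := M.node k with hxdef
  set s := M.step k with hsdef
  set W := M.weight N k with hWdef
  set V := v 0 with hVdef
  set S := (∫ t in (0 : ℝ)..x, t ^ (N - 1) * v t) + v x * M.leftMass N k with hS
  set g := ∫ t in (0 : ℝ)..y, t ^ (N - 1) * v t with hg
  -- Both `S` and `g` exceed the integral up to the left node by an amount between `0` and `V * W`.
  have hSg : |S - g| ≤ V * W := by
    have hsplit := intervalIntegral.integral_add_adjacent_intervals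
      (intervalIntegrable_pow_mul hcont (N - 1) (Set.left_mem_Icc.2 zero_le_one) (node_mem hk.le))
      (intervalIntegrable_pow_mul hcont (N - 1) (node_mem hk.le) hy01)
    have h1 : 0 ≤ ∫ t in x..y, t ^ (N - 1) * v t :=
      intervalIntegral.integral_nonneg hy.1.le fun t ht =>
        mul_nonneg (pow_nonneg (hx0.trans ht.1) _) (hv t ⟨hx0.trans ht.1, ht.2.trans hy01.2⟩)
    have h2 : ∫ t in x..y, t ^ (N - 1) * v t ≤ V * W := by
      calc ∫ t in x..y, t ^ (N - 1) * v t ≤ ∫ t in x..y, t ^ (N - 1) * V := by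
            refine intervalIntegral.integral_mono_on hy.1.le
              (intervalIntegrable_pow_mul hcont (N - 1) (node_mem hk.le) hy01)
              (Continuous.intervalIntegrable (by fun_prop) _ _) fun t ht => ?_
            exact mul_le_mul_of_nonneg_left (hle t ⟨hx0.trans ht.1, ht.2.trans hy01.2⟩)
              (pow_nonneg (hx0.trans ht.1) _)
        _ ≤ ∫ t in x..X, t ^ (N - 1) * V := by
            refine intervalIntegral.integral_mono_interval le_rfl hy.1.le hy.2.le ?_
              (Continuous.intervalIntegrable (by fun_prop) _ _)
            refine (ae_restrict_iff' measurableSet_Ioc).2 (.of_forall fun t ht => ?_)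
            exact mul_nonneg (pow_nonneg (hx0.trans ht.1.le) _) hV0
        _ = V * W := by rw [intervalIntegral.integral_mul_const, mul_comm]; rfl
    have h3 : v x * M.leftMass N k ≤ V * W :=
      mul_le_mul (hle x (node_mem hk.le))
        (by linarith [leftMass_add_rightMass (N := N) hk, rightMass_pos (N := N) hk])
        (leftMass_pos hk).le hV0
    have h4 : 0 ≤ v x * M.leftMass N k :=
      mul_nonneg (hv x (node_mem hk.le)) (leftMass_pos hk).le
    rw [abs_le]
    constructor <;> linarith
  have hgle : |g| ≤ V * (y ^ N / N) := integral_pow_mul_le hN hy01 fun t ht => by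
    have ht' : t ∈ Set.Icc (0 : ℝ) 1 := ⟨ht.1, ht.2.trans hy01.2⟩
    rw [abs_of_nonneg (hv t ht')]
    exact hle t ht'
  have hWl := step_mul_pow_le_weight hN hk
  have hWu := weight_le (N := N) hk
  have hWd := le_weight (N := N) hk
  -- Both terms lie between `s * x ^ (N - 1)` and `s * X ^ (N - 1)`.
  have hdiff : |s * y ^ (N - 1) - W| ≤ s * (X ^ (N - 1) - x ^ (N - 1)) := by
    have h1 : s * x ^ (N - 1) ≤ s * y ^ (N - 1) :=
      mul_le_mul_of_nonneg_left (pow_le_pow_left₀ hx0 hy.1.le _) hs.le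
    have h2 : s * y ^ (N - 1) ≤ s * X ^ (N - 1) :=
      mul_le_mul_of_nonneg_left (pow_le_pow_left₀ hy0.le hy.2.le _) hs.le
    rw [abs_le]
    constructor <;> linarith
  have hpow := mul_pow_sub_pow_le hx0 (M.node_lt k hk).le (N - 1)
  have hfirst : |s / W * (S - g)| ≤ V * s := by
    rw [abs_mul, abs_of_pos (div_pos hs hW)]
    calc s / W * |S - g| ≤ s / W * (V * W) := by gcongr
      _ = V * s := by field_simp
  -- The delicate term near the origin: the bound on `g` supplies an extra factor `y ≤ X`, which
  -- `hpow` needs, and `s * X ^ (N - 1) ≤ N * W` cancels the weight in the denominator.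
  have hsecond : |g * (s * y ^ (N - 1) - W) / (W * y ^ (N - 1))| ≤ V * ((N - 1 : ℕ) * s) := by
    rw [abs_div, abs_mul, abs_of_pos (mul_pos hW hyn), div_le_iff₀ (mul_pos hW hyn)]
    have hyN : y ^ N = y ^ (N - 1) * y := by rw [← pow_succ, Nat.sub_add_cancel hN]
    have hd0 : 0 ≤ X ^ (N - 1) - x ^ (N - 1) :=
      sub_nonneg.2 (pow_le_pow_left₀ hx0 (M.node_lt k hk).le _)
    calc |g| * |s * y ^ (N - 1) - W|
        ≤ V * (y ^ N / N) * (s * (X ^ (N - 1) - x ^ (N - 1))) := by gcongr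
      _ = V * y ^ (N - 1) * s / N * (y * (X ^ (N - 1) - x ^ (N - 1))) := by rw [hyN]; ring
      _ ≤ V * y ^ (N - 1) * s / N * (X * (X ^ (N - 1) - x ^ (N - 1))) := by
          gcongr
          exact hy.2.le
      _ ≤ V * y ^ (N - 1) * s / N * ((N - 1 : ℕ) * (X - x) * X ^ (N - 1)) := by gcongr
      _ = V * y ^ (N - 1) * s / N * (N - 1 : ℕ) * (s * X ^ (N - 1)) := by
          rw [hsdef, step]; ring
      _ ≤ V * y ^ (N - 1) * s / N * (N - 1 : ℕ) * (N * W) := by gcongr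
      _ = V * ((N - 1 : ℕ) * s) * (W * y ^ (N - 1)) := by field_simp
  have hid : M.slope v k + lam * flux N v y =
      -lam * (s / W * (S - g) + g * (s * y ^ (N - 1) - W) / (W * y ^ (N - 1))) := by
    rw [h.slope_eq hk, flux]
    simp only [← hsdef, ← hWdef, ← hxdef, ← hS, ← hg]
    field_simp
    ring
  rw [hid, abs_mul, abs_neg, abs_of_nonneg hlam]
  refine mul_le_mul_of_nonneg_left ?_ hlam
  calc _ ≤ V * s + V * ((N - 1 : ℕ) * s) := (abs_add_le _ _).trans (add_le_add hfirst hsecond)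
    _ = N * s * V := by rw [Nat.cast_sub hN]; push_cast; ring
    _ ≤ N * M.h * V := by
      gcongr
      exact step_le_h hk

/-- The discrete eigenfunction satisfies the differential equation up to `O(h)`. -/
lemma IsEigenfunction.ae_abs_deriv_add_flux_le (h : M.IsEigenfunction N lam v) (hN : 1 ≤ N)
    (hlam : 0 ≤ lam) (hv : ∀ x ∈ Set.Icc (0 : ℝ) 1, 0 ≤ v x) :
    ∀ᵐ y : ℝ, y ∈ Set.Icc (0 : ℝ) 1 →
      |deriv v y + lam * flux N v y| ≤ lam * (N * M.h * v 0) := by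
  filter_upwards [M.ae_mem_Ioo_elem] with y hy hy01
  obtain ⟨k, hk, hyk⟩ := hy hy01
  rw [h.isPiecewiseAffine.deriv_eq hk hyk]
  exact h.abs_slope_add_flux_le hN hlam hv hk hyk

end Mesh

/-! ### The continuous problem: strong form, sign and monotonicity -/

lemma _root_.AbsolutelyContinuousOnInterval.continuousOn_Icc_zero_one {v : ℝ → ℝ}
    (hv : AbsolutelyContinuousOnInterval v 0 1) : ContinuousOn v (Set.Icc 0 1) := by
  rw [← Set.uIcc_of_le zero_le_one]
  exact hv.continuousOn

lemma integral_deriv_eq_sub_of_mem {v : ℝ → ℝ} (hv : AbsolutelyContinuousOnInterval v 0 1)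
    {x y : ℝ} (hx : x ∈ Set.Icc (0 : ℝ) 1) (hy : y ∈ Set.Icc (0 : ℝ) 1) :
    ∫ t in x..y, deriv v t = v y - v x := by
  refine (hv.mono ?_).integral_deriv_eq_sub
  rw [← Set.uIcc_of_le zero_le_one] at hx hy
  exact Set.uIcc_subset_uIcc hx hy

lemma antitoneOn_of_ae_deriv_nonpos {v : ℝ → ℝ} (hv : AbsolutelyContinuousOnInterval v 0 1)
    (h : ∀ᵐ x : ℝ, x ∈ Set.Icc (0 : ℝ) 1 → deriv v x ≤ 0) : AntitoneOn v (Set.Icc 0 1) := by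
  intro x hx y hy hxy
  have h1 := integral_deriv_eq_sub_of_mem hv hx hy
  have h2 : 0 ≤ ∫ t in x..y, -deriv v t := by
    refine intervalIntegral.integral_nonneg_of_ae_restrict hxy ?_
    refine (ae_restrict_iff' measurableSet_Icc).2 ?_
    filter_upwards [h] with t ht htx
    exact neg_nonneg.2 (ht ⟨hx.1.trans htx.1, htx.2.trans hy.2⟩)
  rw [intervalIntegral.integral_neg, h1] at h2
  linarith

lemma abs_sub_le_of_ae_abs_deriv_le {v : ℝ → ℝ} (hv : AbsolutelyContinuousOnInterval v 0 1)
    {C : ℝ} (h : ∀ᵐ x : ℝ, x ∈ Set.Icc (0 : ℝ) 1 → |deriv v x| ≤ C) {x : ℝ}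
    (hx : x ∈ Set.Icc (0 : ℝ) 1) : |v x - v 0| ≤ C * x := by
  have h1 := integral_deriv_eq_sub_of_mem hv (Set.left_mem_Icc.2 zero_le_one) hx
  have h2 := intervalIntegral.norm_integral_le_of_norm_le_const_ae (a := 0) (b := x) (C := C)
    (f := deriv v) (by
      filter_upwards [h] with t ht htx
      rw [Set.uIoc_of_le hx.1] at htx
      exact ht ⟨htx.1.le, htx.2.trans hx.2⟩)
  rwa [h1, Real.norm_eq_abs, sub_zero, abs_of_nonneg hx.1] at h2

lemma intervalIntegrable_pow_mul_of_continuousOn {v : ℝ → ℝ} (hv : ContinuousOn v (Set.Icc 0 1))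
    (n : ℕ) : IntervalIntegrable (fun x => x ^ n * v x) volume 0 1 :=
  Mesh.intervalIntegrable_pow_mul hv n (Set.left_mem_Icc.2 zero_le_one)
    (Set.right_mem_Icc.2 zero_le_one)

/-- Integration by parts against the primitive of `x^(N-1) v`. -/
lemma wInner_eq_neg_integral {N : ℕ} {v w : ℝ → ℝ} (hv : ContinuousOn v (Set.Icc 0 1))
    (hw : AbsolutelyContinuousOnInterval w 0 1) (hw1 : w 1 = 0) :
    wInner N v w = -∫ x in (0 : ℝ)..1, deriv w x * ∫ t in (0 : ℝ)..x, t ^ (N - 1) * v t := by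
  have hint := intervalIntegrable_pow_mul_of_continuousOn hv (N - 1)
  have hac := hint.absolutelyContinuousOnInterval_intervalIntegral
    (c := 0) (by rw [Set.uIcc_of_le zero_le_one]; exact ⟨le_rfl, zero_le_one⟩)
  have h := hw.integral_mul_deriv_eq_deriv_mul hac
  rw [hw1, intervalIntegral.integral_same] at h
  rw [zero_mul, mul_zero, sub_zero, zero_sub] at h
  rw [← h, wInner]
  refine intervalIntegral.integral_congr_ae ?_
  filter_upwards [hint.ae_hasDerivAt_integral] with x hx hx'
  rw [(hx (Set.uIoc_subset_uIcc hx') 0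
    (by rw [Set.uIcc_of_le zero_le_one]; exact ⟨le_rfl, zero_le_one⟩)).deriv]
  ring

lemma MemH1.memLp_Ioc {v : ℝ → ℝ} (hv : MemH1 v) :
    MemLp (deriv v) 2 (volume.restrict (Set.Ioc (0 : ℝ) 1)) := by
  rw [← restrict_Ioo_eq_restrict_Ioc]
  exact hv.2

lemma MemH1.intervalIntegrable_aForm {v w : ℝ → ℝ} (hv : MemH1 v) (hw : MemH1 w) (n : ℕ) :
    IntervalIntegrable (fun x => x ^ n * (deriv v x * deriv w x)) volume 0 1 := by
  have h : IntervalIntegrable (fun x => deriv v x * deriv w x) volume 0 1 := by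
    rw [intervalIntegrable_iff_integrableOn_Ioc_of_le zero_le_one]
    exact hv.memLp_Ioc.integrable_mul hw.memLp_Ioc
  exact h.continuousOn_mul (by fun_prop)

/-- The strong form of the continuous eigenvalue problem. -/
lemma IsEigenfunction.ae_deriv_eq {N : ℕ} {μ : ℝ} {ψ : ℝ → ℝ} (h : IsEigenfunction N μ ψ) :
    ∀ᵐ x : ℝ, x ∈ Set.Icc (0 : ℝ) 1 → deriv ψ x = -μ * flux N ψ x := by
  obtain ⟨⟨hH1, hψ1⟩, -, heq⟩ := h
  have hcont := hH1.1.continuousOn_Icc_zero_one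
  have hint := intervalIntegrable_pow_mul_of_continuousOn hcont (N - 1)
  have h0 : (0 : ℝ) ∈ Set.uIcc (0 : ℝ) 1 := by simp
  have h1 : (1 : ℝ) ∈ Set.uIcc (0 : ℝ) 1 := by simp
  set Ψ : ℝ → ℝ := fun x => ∫ t in (0 : ℝ)..x, t ^ (N - 1) * ψ t with hΨ
  have hΨc : ContinuousOn Ψ (Set.Icc 0 1) :=
    (hint.absolutelyContinuousOnInterval_intervalIntegral h0).continuousOn_Icc_zero_one
  have hΨL : MemLp Ψ 2 (volume.restrict (Set.Ioc (0 : ℝ) 1)) := by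
    obtain ⟨C, hC⟩ := isCompact_Icc.exists_bound_of_continuousOn hΨc
    refine MemLp.of_bound ((hΨc.mono Set.Ioc_subset_Icc_self).aestronglyMeasurable
      measurableSet_Ioc) C ?_
    exact (ae_restrict_iff' measurableSet_Ioc).2
      (.of_forall fun x hx => hC x (Set.Ioc_subset_Icc_self hx))
  -- The claim is `g = 0` almost everywhere. The primitive `χ` of `g` vanishing at `1` is
  -- admissible, and testing with it turns the weak equation into `∫ g ^ 2 = 0`.
  set g : ℝ → ℝ := fun x => x ^ (N - 1) * deriv ψ x + μ * Ψ x with hg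
  have hgL : MemLp g 2 (volume.restrict (Set.Ioc (0 : ℝ) 1)) := by
    refine MemLp.add ?_ (hΨL.const_mul μ)
    refine hH1.memLp_Ioc.of_le (((measurable_id.pow_const _).mul
      (measurable_deriv ψ)).aestronglyMeasurable) ?_
    refine (ae_restrict_iff' measurableSet_Ioc).2 (.of_forall fun x hx => ?_)
    rw [norm_mul]
    refine mul_le_of_le_one_left (norm_nonneg _) ?_
    rw [Real.norm_eq_abs, abs_of_nonneg (pow_nonneg hx.1.le _)]
    exact pow_le_one₀ hx.1.le hx.2
  have hgI : IntervalIntegrable g volume 0 1 := by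
    rw [intervalIntegrable_iff_integrableOn_Ioc_of_le zero_le_one]
    exact hgL.integrable one_le_two
  set χ : ℝ → ℝ := fun x => ∫ t in (1 : ℝ)..x, g t with hχ
  have hχac : AbsolutelyContinuousOnInterval χ 0 1 :=
    hgI.absolutelyContinuousOnInterval_intervalIntegral h1
  have hχd : ∀ᵐ x : ℝ, x ∈ Set.uIoc (0 : ℝ) 1 → deriv χ x = g x := by
    filter_upwards [hgI.ae_hasDerivAt_integral] with x hx hx'
    exact (hx (Set.uIoc_subset_uIcc hx') 1 h1).deriv
  have hχ1 : χ 1 = 0 := intervalIntegral.integral_same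
  have hχH : MemH1dot χ := by
    refine ⟨⟨hχac, ?_⟩, hχ1⟩
    rw [restrict_Ioo_eq_restrict_Ioc]
    refine hgL.ae_eq ?_
    refine (ae_restrict_iff' measurableSet_Ioc).2 ?_
    rw [Set.uIoc_of_le zero_le_one] at hχd
    filter_upwards [hχd] with x hx hx'
    exact (hx hx').symm
  have key := heq χ hχH
  rw [wInner_eq_neg_integral hcont hχac hχ1] at key
  have hsq : ∫ x in (0 : ℝ)..1, g x ^ 2 = 0 := by
    have e : ∫ x in (0 : ℝ)..1, g x ^ 2 =
        ∫ x in (0 : ℝ)..1, x ^ (N - 1) * (deriv ψ x * deriv χ x) + μ * (deriv χ x * Ψ x) := by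
      refine intervalIntegral.integral_congr_ae ?_
      filter_upwards [hχd] with x hx hx'
      rw [hx hx', hg]
      ring
    rw [e, intervalIntegral.integral_add (hH1.intervalIntegrable_aForm hχH.1 _),
      intervalIntegral.integral_const_mul]
    · rw [aForm] at key
      rw [key]; ring
    · refine IntervalIntegrable.const_mul ?_ μ
      refine hχac.intervalIntegrable_deriv.mul_continuousOn ?_
      rwa [Set.uIcc_of_le zero_le_one]
  rw [intervalIntegral.integral_of_le zero_le_one,
    integral_eq_zero_iff_of_nonneg (fun x => sq_nonneg _) hgL.integrable_sq] at hsq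
  have hsq' := (ae_restrict_iff' measurableSet_Ioc).1 hsq
  filter_upwards [hsq', Measure.ae_ne volume 0] with x hx hx0 hx01
  have hxpos : 0 < x := lt_of_le_of_ne hx01.1 hx0.symm
  have hgx := pow_eq_zero_iff (two_ne_zero) |>.1 (hx ⟨hxpos, hx01.2⟩)
  have hp : x ^ (N - 1) ≠ 0 := (pow_pos hxpos _).ne'
  rw [flux, ← mul_div_assoc, eq_div_iff hp]
  simp only [hg, hΨ] at hgx
  linarith

lemma integral_pow_mul_nonpos {N : ℕ} {v : ℝ → ℝ} (h : ∀ x ∈ Set.Icc (0 : ℝ) 1, v x ≤ 0) :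
    ∫ x in (0 : ℝ)..1, x ^ (N - 1) * v x ≤ 0 := by
  have : 0 ≤ ∫ x in (0 : ℝ)..1, -(x ^ (N - 1) * v x) :=
    intervalIntegral.integral_nonneg zero_le_one fun x hx =>
      neg_nonneg.2 (mul_nonpos_of_nonneg_of_nonpos (pow_nonneg hx.1 _) (h x hx))
  rw [intervalIntegral.integral_neg] at this
  linarith

lemma flux_nonneg {N : ℕ} {v : ℝ → ℝ} (h : ∀ x ∈ Set.Icc (0 : ℝ) 1, 0 ≤ v x) {y : ℝ}
    (hy : y ∈ Set.Icc (0 : ℝ) 1) : 0 ≤ flux N v y :=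
  div_nonneg (intervalIntegral.integral_nonneg hy.1 fun x hx =>
    mul_nonneg (pow_nonneg hx.1 _) (h x ⟨hx.1, hx.2.trans hy.2⟩)) (pow_nonneg hy.1 _)

/-- A nonnegative normalized eigenfunction has a positive eigenvalue and is positive and largest
at the origin. -/
lemma IsEigenfunction.pos_of_isNormalized {N : ℕ} {μ : ℝ} {ψ : ℝ → ℝ}
    (h : IsEigenfunction N μ ψ) (hn : IsNormalized N ψ) :
    0 < μ ∧ 0 < ψ 0 ∧ ∀ x ∈ Set.Icc (0 : ℝ) 1, ψ x ≤ ψ 0 := by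
  have hac := h.1.1.1
  have hμ : 0 < μ := by
    by_contra! hμ
    -- For `μ ≤ 0` the function `ψ` would increase to `ψ 1 = 0`, against its integral being `1`.
    have hanti : AntitoneOn (fun x => -ψ x) (Set.Icc 0 1) := by
      refine antitoneOn_of_ae_deriv_nonpos hac.fun_neg ?_
      filter_upwards [h.ae_deriv_eq] with x hx hx01
      rw [deriv.fun_neg, hx hx01, neg_mul, neg_neg]
      exact mul_nonpos_of_nonpos_of_nonneg hμ (flux_nonneg hn.1 hx01)
    have hle : ∀ x ∈ Set.Icc (0 : ℝ) 1, ψ x ≤ 0 := fun x hx => by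
      have := hanti hx (Set.right_mem_Icc.2 zero_le_one) hx.2
      have h1 := h.1.2
      simp only at this
      linarith
    have := integral_pow_mul_nonpos (N := N) hle
    linarith [hn.2]
  have hanti : AntitoneOn ψ (Set.Icc 0 1) := by
    refine antitoneOn_of_ae_deriv_nonpos hac ?_
    filter_upwards [h.ae_deriv_eq] with x hx hx01
    rw [hx hx01]
    exact mul_nonpos_of_nonpos_of_nonneg (by linarith) (flux_nonneg hn.1 hx01)
  have hle : ∀ x ∈ Set.Icc (0 : ℝ) 1, ψ x ≤ ψ 0 := fun x hx =>
    hanti (Set.left_mem_Icc.2 zero_le_one) hx hx.1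
  refine ⟨hμ, ?_, hle⟩
  by_contra! h0
  have := integral_pow_mul_nonpos (N := N) fun x hx => (hle x hx).trans h0
  linarith [hn.2]

lemma IsEigenfunction.ae_abs_deriv_le {N : ℕ} {μ : ℝ} {ψ : ℝ → ℝ}
    (h : IsEigenfunction N μ ψ) (hn : IsNormalized N ψ) (hN : 1 ≤ N) :
    ∀ᵐ x : ℝ, x ∈ Set.Icc (0 : ℝ) 1 → |flux N ψ x| ≤ ψ 0 ∧ |deriv ψ x| ≤ μ * ψ 0 := by
  obtain ⟨hμ, -, hle⟩ := h.pos_of_isNormalized hn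
  filter_upwards [h.ae_deriv_eq, Measure.ae_ne volume 0] with x hx hx0 hx01
  have hfl := abs_flux_le (v := ψ) (V := ψ 0) hN ⟨lt_of_le_of_ne hx01.1 hx0.symm, hx01.2⟩
    fun t ht => by
      have ht' : t ∈ Set.Icc (0 : ℝ) 1 := ⟨ht.1, ht.2.trans hx01.2⟩
      rw [abs_of_nonneg (hn.1 t ht')]
      exact hle t ht'
  refine ⟨hfl, ?_⟩
  rw [hx hx01, abs_mul, abs_neg, abs_of_pos hμ]
  exact mul_le_mul_of_nonneg_left hfl hμ.le

/-! ### Stability and convergence of the eigenvalue -/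

/-- A Grönwall estimate for the differential inequality `|w'| ≤ L |flux w| + δ`. -/
lemma abs_le_of_ae_abs_deriv_le_flux {N : ℕ} {w : ℝ → ℝ} {L δ : ℝ} (hN : 1 ≤ N) (hL : 0 ≤ L)
    (hδ : 0 ≤ δ) (hw : AbsolutelyContinuousOnInterval w 0 1) (hw0 : w 0 = 0)
    (h : ∀ᵐ x : ℝ, x ∈ Set.Icc (0 : ℝ) 1 → |deriv w x| ≤ L * |flux N w x| + δ) :
    ∀ x ∈ Set.Icc (0 : ℝ) 1, |w x| ≤ 2 * δ * Real.exp (2 * L) := by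
  have hcont := hw.continuousOn_Icc_zero_one
  -- Maximizing `|w|` against the weight `exp (-2 L x)` handles the nonlocal flux; the rate `2 L`
  -- makes the integrated flux term at most half of the left side, which is then absorbed.
  have hfc : ContinuousOn (fun x => |w x| * Real.exp (-(2 * L * x))) (Set.Icc 0 1) :=
    hcont.abs.mul (by fun_prop)
  obtain ⟨x₀, hx₀, hmax⟩ := isCompact_Icc.exists_isMaxOn
    (Set.nonempty_Icc.2 zero_le_one) hfc
  set K := |w x₀| * Real.exp (-(2 * L * x₀)) with hK
  have hK0 : 0 ≤ K := by positivity
  have hwK : ∀ x ∈ Set.Icc (0 : ℝ) 1, |w x| ≤ K * Real.exp (2 * L * x) := fun x hx => by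
    have h1 : |w x| * Real.exp (-(2 * L * x)) ≤ K := hmax hx
    rwa [Real.exp_neg, ← div_eq_mul_inv, div_le_iff₀ (Real.exp_pos _)] at h1
  have hbound : |w x₀| ≤ ∫ y in (0 : ℝ)..x₀, (K / 2 * (Real.exp (2 * L * y) * (2 * L)) + δ) := by
    have h1 := integral_deriv_eq_sub_of_mem hw (Set.left_mem_Icc.2 zero_le_one) hx₀
    rw [hw0, sub_zero] at h1
    rw [← h1, ← Real.norm_eq_abs]
    refine intervalIntegral.norm_integral_le_of_norm_le hx₀.1 ?_
      (Continuous.intervalIntegrable (by fun_prop) _ _)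
    filter_upwards [h] with y hy hyx
    have hy1 : y ≤ 1 := hyx.2.trans hx₀.2
    have hfl : |flux N w y| ≤ K * Real.exp (2 * L * y) :=
      abs_flux_le hN ⟨hyx.1, hy1⟩ fun t ht =>
        (hwK t ⟨ht.1, ht.2.trans hy1⟩).trans (by
          have := ht.2
          gcongr)
    calc ‖deriv w y‖ ≤ L * |flux N w y| + δ := hy ⟨hyx.1.le, hy1⟩
      _ ≤ L * (K * Real.exp (2 * L * y)) + δ := by gcongr
      _ = _ := by ring
  have hint : ∫ y in (0 : ℝ)..x₀, (K / 2 * (Real.exp (2 * L * y) * (2 * L)) + δ) =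
      (K / 2 * Real.exp (2 * L * x₀) + δ * x₀) - (K / 2 * Real.exp (2 * L * 0) + δ * 0) := by
    refine intervalIntegral.integral_eq_sub_of_hasDerivAt
      (f := fun y => K / 2 * Real.exp (2 * L * y) + δ * y) (fun y _ => ?_)
      (Continuous.intervalIntegrable (by fun_prop) _ _)
    have h1 : HasDerivAt (fun y : ℝ => 2 * L * y) (2 * L) y := by
      simpa using (hasDerivAt_id y).const_mul (2 * L)
    have h2 : HasDerivAt (fun y : ℝ => δ * y) δ y := by
      simpa using (hasDerivAt_id y).const_mul δ
    exact (h1.exp.const_mul (K / 2)).add h2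
  rw [hint, mul_zero, Real.exp_zero, mul_zero, mul_one, add_zero] at hbound
  have hKe : |w x₀| = K * Real.exp (2 * L * x₀) := by
    rw [hK, mul_assoc, ← Real.exp_add, neg_add_cancel, Real.exp_zero, mul_one]
  have h1 : 1 ≤ Real.exp (2 * L * x₀) := Real.one_le_exp (by have := hx₀.1; positivity)
  have hK2 : K ≤ 2 * δ := by
    have h2 : δ * x₀ ≤ δ := mul_le_of_le_one_right hδ hx₀.2
    rw [hKe] at hbound
    nlinarith
  intro x hx
  exact (hwK x hx).trans (mul_le_mul hK2
    (Real.exp_le_exp.2 (mul_le_of_le_one_right (by positivity) hx.2)) (Real.exp_pos _).le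
    (by positivity))

lemma pow_mul_flux {N : ℕ} {v : ℝ → ℝ} {x : ℝ} (hx : 0 < x) :
    x ^ (N - 1) * flux N v x = ∫ t in (0 : ℝ)..x, t ^ (N - 1) * v t := by
  rw [flux, mul_div_cancel₀ _ (pow_pos hx _).ne']

lemma wInner_comm (N : ℕ) (v w : ℝ → ℝ) : wInner N v w = wInner N w v := by
  simp only [wInner, mul_comm (v _)]

/-- If `v` solves the eigenvalue equation for `lam` up to `ρ`, then `lam` is close to `μ`. -/
lemma IsEigenfunction.abs_sub_mul_wInner_le {N : ℕ} {μ lam ρ B : ℝ} {ψ v : ℝ → ℝ}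
    (h : IsEigenfunction N μ ψ) (hv : MemH1dot v)
    (hB : ∀ᵐ x : ℝ, x ∈ Set.Icc (0 : ℝ) 1 → |deriv ψ x| ≤ B)
    (hρ : ∀ᵐ x : ℝ, x ∈ Set.Icc (0 : ℝ) 1 → |deriv v x + lam * flux N v x| ≤ ρ) :
    |(μ - lam) * wInner N ψ v| ≤ B * ρ := by
  have hvc := hv.1.1.continuousOn_Icc_zero_one
  have h1 := h.2.2 v hv
  have h2 := wInner_eq_neg_integral (N := N) hvc h.1.1.1 h.1.2
  have hmom : IntervalIntegrable
      (fun x => deriv ψ x * ∫ t in (0 : ℝ)..x, t ^ (N - 1) * v t) volume 0 1 := by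
    refine h.1.1.1.intervalIntegrable_deriv.mul_continuousOn ?_
    refine ((intervalIntegrable_pow_mul_of_continuousOn hvc (N - 1)
      ).absolutelyContinuousOnInterval_intervalIntegral ?_).continuousOn
    simp
  -- The weak equation for `ψ` tested with `v` gives the factor `μ`; integrating `(v, ψ)` by parts
  -- gives the factor `lam`. The integrand is `ψ'` times the weighted residual of `v`.
  have e : (μ - lam) * wInner N ψ v = ∫ x in (0 : ℝ)..1, (x ^ (N - 1) * (deriv ψ x * deriv v x) +
      lam * (deriv ψ x * ∫ t in (0 : ℝ)..x, t ^ (N - 1) * v t)) := by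
    rw [intervalIntegral.integral_add (h.1.1.intervalIntegrable_aForm hv.1 _)
      (hmom.const_mul lam), intervalIntegral.integral_const_mul]
    have h3 : aForm N ψ v = ∫ x in (0 : ℝ)..1, x ^ (N - 1) * (deriv ψ x * deriv v x) := rfl
    rw [← h3, h1, sub_mul, wInner_comm N ψ v, h2]
    ring
  rw [e]
  have := intervalIntegral.norm_integral_le_of_norm_le_const_ae (a := 0) (b := 1) (C := B * ρ)
    (f := fun x => x ^ (N - 1) * (deriv ψ x * deriv v x) +
      lam * (deriv ψ x * ∫ t in (0 : ℝ)..x, t ^ (N - 1) * v t)) (by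
    filter_upwards [hB, hρ] with x hx1 hx2 hx
    rw [Set.uIoc_of_le zero_le_one] at hx
    have hx' := Set.Ioc_subset_Icc_self hx
    rw [← pow_mul_flux hx.1, show x ^ (N - 1) * (deriv ψ x * deriv v x) +
      lam * (deriv ψ x * (x ^ (N - 1) * flux N v x)) =
      x ^ (N - 1) * (deriv ψ x * (deriv v x + lam * flux N v x)) by ring, Real.norm_eq_abs, abs_mul,
      abs_mul, abs_of_nonneg (pow_nonneg hx.1.le _)]
    have hB0 := (abs_nonneg _).trans (hx1 hx')
    calc x ^ (N - 1) * (|deriv ψ x| * |deriv v x + lam * flux N v x|)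
        ≤ 1 * (B * ρ) := mul_le_mul (pow_le_one₀ hx.1.le hx.2)
          (mul_le_mul (hx1 hx') (hx2 hx') (abs_nonneg _) hB0) (by positivity) zero_le_one
      _ = B * ρ := one_mul _)
  simpa using this

lemma le_wInner_of_le {N : ℕ} {v w : ℝ → ℝ} (hN : 1 ≤ N) (hv : ContinuousOn v (Set.Icc 0 1))
    (hw : ContinuousOn w (Set.Icc 0 1)) (hv0 : ∀ x ∈ Set.Icc (0 : ℝ) 1, 0 ≤ v x)
    (hw0 : ∀ x ∈ Set.Icc (0 : ℝ) 1, 0 ≤ w x) {r a b : ℝ} (hr : r ∈ Set.Icc (0 : ℝ) 1)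
    (ha : 0 ≤ a) (hva : ∀ x ∈ Set.Icc 0 r, a ≤ v x) (hb : 0 ≤ b)
    (hwb : ∀ x ∈ Set.Icc 0 r, b ≤ w x) :
    a * b * (r ^ N / N) ≤ wInner N v w := by
  have hint := intervalIntegrable_pow_mul_of_continuousOn (hv.mul hw) (N - 1)
  calc a * b * (r ^ N / N) = ∫ x in (0 : ℝ)..r, x ^ (N - 1) * (a * b) := by
        rw [intervalIntegral.integral_mul_const, integral_pow, Nat.sub_add_cancel hN,
          zero_pow (by omega), Nat.cast_sub hN]
        push_cast
        rw [sub_add_cancel, sub_zero]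
        ring
    _ ≤ ∫ x in (0 : ℝ)..r, x ^ (N - 1) * (v x * w x) := by
        refine intervalIntegral.integral_mono_on hr.1
          (Continuous.intervalIntegrable (by fun_prop) _ _)
          (Mesh.intervalIntegrable_pow_mul (hv.mul hw) (N - 1)
            (Set.left_mem_Icc.2 zero_le_one) hr) fun x hx => ?_
        exact mul_le_mul_of_nonneg_left
          (mul_le_mul (hva x hx) (hwb x hx) hb (ha.trans (hva x hx))) (pow_nonneg hx.1 _)
    _ ≤ wInner N v w := by
        refine intervalIntegral.integral_mono_interval le_rfl hr.1 hr.2 ?_ hint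
        refine (ae_restrict_iff' measurableSet_Ioc).2 (.of_forall fun x hx => ?_)
        have hx' := Set.Ioc_subset_Icc_self hx
        exact mul_nonneg (pow_nonneg hx.1.le _) (mul_nonneg (hv0 x hx') (hw0 x hx'))

lemma half_le_of_abs_sub_le {v : ℝ → ℝ} {V C K x : ℝ} (hK : 0 < K) (hCK : C ≤ K * V)
    (hV : 0 ≤ V) (h : |v x - V| ≤ C * x) (hx : x ∈ Set.Icc 0 (1 / (2 * K))) : V / 2 ≤ v x := by
  have h1 : C * x ≤ K * V * (1 / (2 * K)) :=
    mul_le_mul hCK hx.2 hx.1 (by positivity)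
  have h2 : K * V * (1 / (2 * K)) = V / 2 := by field_simp
  have := (abs_le.1 h).1
  linarith

namespace Mesh

variable {M : Mesh} {N : ℕ} {lam : ℝ} {v : ℝ → ℝ}

lemma IsEigenfunction.apply_zero_pos (h : M.IsEigenfunction N lam v) (hlam : 0 ≤ lam)
    (hv : ∀ x ∈ Set.Icc (0 : ℝ) 1, 0 ≤ v x) : 0 < v 0 := by
  obtain ⟨x, hx, hne⟩ := h.2.1
  exact (lt_of_le_of_ne (hv x hx) hne.symm).trans_le (h.le_apply_zero hlam hv x hx)

lemma exists_nonneg_eigenfunction (hl : IsLeast (M.eigenvalues N) lam) :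
    ∃ v, M.IsEigenfunction N lam v ∧ ∀ x ∈ Set.Icc (0 : ℝ) 1, 0 ≤ v x := by
  obtain ⟨v, hv⟩ := hl.1
  have habs := hv.isChainEigenvector.abs (fun k hk => coupling_pos hk)
    (isRayleighBound_of_isLeast hl)
  refine ⟨_, isEigenfunction_interp habs ?_, ?_⟩
  · obtain ⟨i, hi, hne⟩ := hv.exists_node_ne_zero
    exact ⟨i, hi, abs_ne_zero.2 hne⟩
  · refine (isPiecewiseAffine_interp habs.1).nonneg fun k hk => ?_
    rw [interp_node habs.1 hk]
    exact abs_nonneg _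

/-- Linear convergence of the smallest eigenvalue. -/
lemma exists_abs_sub_le {N : ℕ} (hN : 1 ≤ N) {μ : ℝ} {ψ : ℝ → ℝ}
    (hψ : RadialFEM.IsEigenfunction N μ ψ) (hψn : IsNormalized N ψ) :
    ∃ C : ℝ, 0 ≤ C ∧ ∀ M : Mesh, M.h ≤ 1 → ∀ lam : ℝ, IsLeast (M.eigenvalues N) lam →
      |lam - μ| ≤ C * M.h := by
  obtain ⟨hμ, hb, hψle⟩ := hψ.pos_of_isNormalized hψn
  have hN0 : (0 : ℝ) < N := by exact_mod_cast hN
  set Λ : ℝ := (N + 1 : ℝ) ^ 2 with hΛ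
  have hΛ1 : 1 ≤ Λ := by rw [hΛ]; nlinarith
  -- `K` bounds `|ψ'| / ψ 0` and `|v'| / v 0` for every mesh with `h ≤ 1`, so on `[0, 1 / (2 K)]`
  -- both functions keep at least half of their value at `0`.
  set K : ℝ := μ + Λ * (1 + N) with hK
  have hK1 : 1 ≤ K := by rw [hK]; nlinarith
  have hK0 : 0 < K := by linarith
  set r : ℝ := 1 / (2 * K) with hr
  have hr0 : 0 < r := by positivity
  have hr1 : r ≤ 1 := by rw [hr, div_le_one (by positivity)]; linarith
  -- This is `μ ψ(0) · Λ N v(0)` divided by the lower bound `(ψ(0) / 2) (v(0) / 2) r^N / N` of `(ψ,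
  -- v)`; the values at `0` cancel.
  refine ⟨4 * N ^ 2 * μ * Λ / r ^ N, by positivity, fun M hM lam hl => ?_⟩
  obtain ⟨v, hv, hv0⟩ := exists_nonneg_eigenfunction hl
  have hlam := pos_of_isLeast hl
  have hlamΛ : lam ≤ Λ := le_of_isLeast hN hl
  have hV := hv.apply_zero_pos hlam.le hv0
  have hvle := hv.le_apply_zero hlam.le hv0
  have hres := hv.ae_abs_deriv_add_flux_le hN hlam.le hv0
  have hψd : ∀ᵐ x : ℝ, x ∈ Set.Icc (0 : ℝ) 1 → |deriv ψ x| ≤ μ * ψ 0 := by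
    filter_upwards [hψ.ae_abs_deriv_le hψn hN] with x hx hx01
    exact (hx hx01).2
  have hvd : ∀ᵐ x : ℝ, x ∈ Set.Icc (0 : ℝ) 1 → |deriv v x| ≤ Λ * (1 + N) * v 0 := by
    filter_upwards [hres, Measure.ae_ne volume 0] with x hx hx0 hx01
    have hfl := abs_flux_le (v := v) (V := v 0) hN ⟨lt_of_le_of_ne hx01.1 hx0.symm, hx01.2⟩
      fun t ht => by
        have ht' : t ∈ Set.Icc (0 : ℝ) 1 := ⟨ht.1, ht.2.trans hx01.2⟩
        rw [abs_of_nonneg (hv0 t ht')]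
        exact hvle t ht'
    calc |deriv v x| = |(deriv v x + lam * flux N v x) - lam * flux N v x| := by ring_nf
      _ ≤ |deriv v x + lam * flux N v x| + |lam * flux N v x| := abs_sub _ _
      _ ≤ lam * (N * M.h * v 0) + lam * v 0 := by
          rw [abs_mul lam, abs_of_pos hlam]
          exact add_le_add (hx hx01) (mul_le_mul_of_nonneg_left hfl hlam.le)
      _ ≤ Λ * (N * 1 * v 0) + Λ * v 0 := by
          have := h_nonneg (M := M)
          gcongr
      _ = _ := by ring
  have hmain := hψ.abs_sub_mul_wInner_le ⟨hv.1.1, hv.1.2.2⟩ hψd hres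
  have hψlow : ∀ x ∈ Set.Icc 0 r, ψ 0 / 2 ≤ ψ x := fun x hx =>
    half_le_of_abs_sub_le (C := μ * ψ 0) hK0 (mul_le_mul_of_nonneg_right (by
      rw [hK]; nlinarith) hb.le) hb.le
      (abs_sub_le_of_ae_abs_deriv_le hψ.1.1.1 hψd ⟨hx.1, hx.2.trans hr1⟩) hx
  have hvlow : ∀ x ∈ Set.Icc 0 r, v 0 / 2 ≤ v x := fun x hx =>
    half_le_of_abs_sub_le (C := Λ * (1 + N) * v 0) hK0 (mul_le_mul_of_nonneg_right (by
      rw [hK]; linarith) hV.le) hV.le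
      (abs_sub_le_of_ae_abs_deriv_le hv.1.1.1 hvd ⟨hx.1, hx.2.trans hr1⟩) hx
  have hlow := le_wInner_of_le hN hψ.1.1.1.continuousOn_Icc_zero_one
    hv.isPiecewiseAffine.continuousOn hψn.1 hv0 ⟨hr0.le, hr1⟩ (half_pos hb).le hψlow
    (half_pos hV).le hvlow
  have hpos : 0 < ψ 0 / 2 * (v 0 / 2) * (r ^ N / N) := by positivity
  rw [abs_mul, abs_of_pos (hpos.trans_le hlow), abs_sub_comm] at hmain
  have h1 : |lam - μ| * (ψ 0 / 2 * (v 0 / 2) * (r ^ N / N)) ≤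
      μ * ψ 0 * (Λ * (N * M.h * v 0)) := by
    refine (mul_le_mul_of_nonneg_left hlow (abs_nonneg _)).trans (hmain.trans ?_)
    have := h_nonneg (M := M)
    gcongr
  rw [← le_div_iff₀ hpos] at h1
  refine h1.trans (le_of_eq ?_)
  field_simp
  ring

end Mesh

/-! ### Convergence of the normalized eigenfunction -/

lemma integral_pow_mul_comb {N : ℕ} {v w : ℝ → ℝ} (hv : ContinuousOn v (Set.Icc 0 1))
    (hw : ContinuousOn w (Set.Icc 0 1)) (a b : ℝ) {y : ℝ} (hy : y ∈ Set.Icc (0 : ℝ) 1) :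
    ∫ x in (0 : ℝ)..y, x ^ (N - 1) * (a * v x - b * w x) =
      a * (∫ x in (0 : ℝ)..y, x ^ (N - 1) * v x) - b * ∫ x in (0 : ℝ)..y, x ^ (N - 1) * w x := by
  have h0 := Set.left_mem_Icc.2 (zero_le_one (α := ℝ))
  rw [← intervalIntegral.integral_const_mul, ← intervalIntegral.integral_const_mul,
    ← intervalIntegral.integral_sub ((Mesh.intervalIntegrable_pow_mul hv _ h0 hy).const_mul a)
      ((Mesh.intervalIntegrable_pow_mul hw _ h0 hy).const_mul b)]
  refine intervalIntegral.integral_congr fun x _ => ?_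
  ring

lemma flux_comb {N : ℕ} {v w : ℝ → ℝ} (hv : ContinuousOn v (Set.Icc 0 1))
    (hw : ContinuousOn w (Set.Icc 0 1)) (a b : ℝ) {y : ℝ} (hy : y ∈ Set.Icc (0 : ℝ) 1) :
    flux N (fun x => a * v x - b * w x) y = a * flux N v y - b * flux N w y := by
  rw [flux, integral_pow_mul_comb hv hw a b hy, flux, flux]
  ring

lemma ae_deriv_comb {v w : ℝ → ℝ} (hv : AbsolutelyContinuousOnInterval v 0 1)
    (hw : AbsolutelyContinuousOnInterval w 0 1) (a b : ℝ) :
    ∀ᵐ x : ℝ, x ∈ Set.Icc (0 : ℝ) 1 →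
      deriv (fun x => a * v x - b * w x) x = a * deriv v x - b * deriv w x := by
  filter_upwards [hv.ae_differentiableAt, hw.ae_differentiableAt] with x h1 h2 hx
  rw [← Set.uIcc_of_le zero_le_one] at hx
  exact (((h1 hx).hasDerivAt.const_mul a).sub ((h2 hx).hasDerivAt.const_mul b)).deriv

lemma energySeminorm_le {N : ℕ} {v : ℝ → ℝ} {C : ℝ} (hC : 0 ≤ C)
    (h : ∀ᵐ x : ℝ, x ∈ Set.Icc (0 : ℝ) 1 → |deriv v x| ≤ C) : energySeminorm N v ≤ C := by
  rw [energySeminorm, Real.sqrt_le_left hC, aForm]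
  have := intervalIntegral.norm_integral_le_of_norm_le_const_ae (a := 0) (b := 1) (C := C ^ 2)
    (f := fun x => x ^ (N - 1) * (deriv v x * deriv v x)) (by
    filter_upwards [h] with x hx hx'
    rw [Set.uIoc_of_le zero_le_one] at hx'
    rw [Real.norm_eq_abs, abs_mul, abs_of_nonneg (pow_nonneg hx'.1.le _), abs_mul]
    calc x ^ (N - 1) * (|deriv v x| * |deriv v x|) ≤ 1 * (C * C) :=
          mul_le_mul (pow_le_one₀ hx'.1.le hx'.2)
            (mul_self_le_mul_self (abs_nonneg _) (hx (Set.Ioc_subset_Icc_self hx')))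
            (by positivity) zero_le_one
      _ = C ^ 2 := by ring)
  simpa using (le_abs_self _).trans this

/-- Stability: if `v` solves the eigenvalue equation for `lam` up to `ρ * v 0`, then the
normalized functions `v` and `ψ` are close in energy. -/
lemma IsEigenfunction.energySeminorm_sub_le {N : ℕ} {μ lam ρ Λ η E : ℝ} {ψ v : ℝ → ℝ} (hN : 1 ≤ N)
    (hψ : IsEigenfunction N μ ψ) (hψn : IsNormalized N ψ)
    (hv : AbsolutelyContinuousOnInterval v 0 1) (hvn : IsNormalized N v)
    (hV : 0 < v 0) (hlam : 0 ≤ lam) (hΛ : lam ≤ Λ)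
    (hres : ∀ᵐ x : ℝ, x ∈ Set.Icc (0 : ℝ) 1 → |deriv v x + lam * flux N v x| ≤ ρ * v 0)
    (hη : ρ + |lam - μ| ≤ η) (hη0 : 0 ≤ η) (hE : E = 2 * Real.exp (2 * Λ))
    (hsmall : ψ 0 * E * η ≤ 1 / 2) :
    energySeminorm N (fun x => v x - ψ x) ≤ 2 * ψ 0 * (Λ * E + 1 + E * (μ * ψ 0)) * η := by
  obtain ⟨hμ, hb, -⟩ := hψ.pos_of_isNormalized hψn
  have hψac := hψ.1.1.1
  have hvc := hv.continuousOn_Icc_zero_one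
  have hψc := hψac.continuousOn_Icc_zero_one
  have hE0 : 0 < E := by rw [hE]; positivity
  have hΛ0 : 0 ≤ Λ := hlam.trans hΛ
  set b := ψ 0 with hbdef
  set V := v 0 with hVdef
  -- Cross-multiplying by the values at `0` gives `w 0 = 0`, so the Grönwall estimate applies before
  -- `v 0` and `ψ 0` have been compared.
  set w : ℝ → ℝ := fun x => b * v x - V * ψ x with hw
  have hwac : AbsolutelyContinuousOnInterval w 0 1 := (hv.const_mul b).fun_sub (hψac.const_mul V)
  have hwd := ae_deriv_comb hv hψac b V
  have hw' : ∀ᵐ x : ℝ, x ∈ Set.Icc (0 : ℝ) 1 → |deriv w x| ≤ Λ * |flux N w x| + b * V * η := by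
    filter_upwards [hwd, hres, hψ.ae_deriv_eq, hψ.ae_abs_deriv_le hψn hN] with x h1 h2 h3 h4 hx
    have hid : deriv w x = b * (deriv v x + lam * flux N v x) + -(lam * flux N w x) +
        V * ((μ - lam) * flux N ψ x) := by
      rw [h1 hx, h3 hx, flux_comb hvc hψc b V hx]
      ring
    rw [hid]
    have e1 : |b * (deriv v x + lam * flux N v x)| ≤ b * (ρ * V) := by
      rw [abs_mul, abs_of_pos hb]
      exact mul_le_mul_of_nonneg_left (h2 hx) hb.le
    have e2 : |-(lam * flux N w x)| ≤ Λ * |flux N w x| := by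
      rw [abs_neg, abs_mul, abs_of_nonneg hlam]
      exact mul_le_mul_of_nonneg_right hΛ (abs_nonneg _)
    have e3 : |V * ((μ - lam) * flux N ψ x)| ≤ V * (|lam - μ| * b) := by
      rw [abs_mul, abs_mul, abs_of_pos hV, abs_sub_comm μ]
      have := (h4 hx).1
      gcongr
    have e4 : b * V * (ρ + |lam - μ|) ≤ b * V * η := by gcongr
    have := abs_add_three (b * (deriv v x + lam * flux N v x)) (-(lam * flux N w x))
      (V * ((μ - lam) * flux N ψ x))
    linarith
  have hwE : ∀ x ∈ Set.Icc (0 : ℝ) 1, |w x| ≤ b * V * η * E := fun x hx => by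
    have := abs_le_of_ae_abs_deriv_le_flux hN hΛ0 (by positivity) hwac
      (by simp only [hw, ← hbdef, ← hVdef]; ring) hw' x hx
    rw [hE]
    linarith
  -- Both functions have weighted integral `1`, so that of `w` is exactly `b - V`.
  have hbV : |V - b| ≤ b * V * η * E := by
    have h1 := integral_pow_mul_le (v := w) hN (Set.right_mem_Icc.2 zero_le_one) hwE
    rw [integral_pow_mul_comb hvc hψc b V (Set.right_mem_Icc.2 zero_le_one), hvn.2, hψn.2,
      mul_one, mul_one, abs_sub_comm, one_pow] at h1
    refine h1.trans (mul_le_of_le_one_right (by positivity) ?_)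
    rw [div_le_one (by exact_mod_cast hN)]
    exact_mod_cast hN
  have hV2 : V ≤ 2 * b := by
    have h1 := (abs_le.1 hbV).2
    have h2 : b * V * η * E = V * (b * E * η) := by ring
    have h3 : V * (b * E * η) ≤ V * (1 / 2) := mul_le_mul_of_nonneg_left hsmall hV.le
    linarith
  refine energySeminorm_le (by positivity) ?_
  have hsub := ae_deriv_comb hv hψac 1 1
  simp only [one_mul] at hsub
  filter_upwards [hsub, hwd, hw', hψ.ae_abs_deriv_le hψn hN, Measure.ae_ne volume 0]
    with x h1 h2 h3 h4 hx0 hx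
  have hfl : |flux N w x| ≤ b * V * η * E :=
    abs_flux_le hN ⟨lt_of_le_of_ne hx.1 hx0.symm, hx.2⟩
      fun t ht => hwE t ⟨ht.1, ht.2.trans hx.2⟩
  have hid : b * (deriv v x - deriv ψ x) = deriv w x + (V - b) * deriv ψ x := by
    rw [h2 hx]; ring
  have e1 : |deriv w x| ≤ Λ * (b * V * η * E) + b * V * η :=
    (h3 hx).trans (by gcongr)
  have e2 : |(V - b) * deriv ψ x| ≤ b * V * η * E * (μ * b) := by
    rw [abs_mul]
    exact mul_le_mul hbV (h4 hx).2 (abs_nonneg _) (by positivity)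
  have e3 : b * |deriv v x - deriv ψ x| ≤ b * (V * ((Λ * E + 1 + E * (μ * b)) * η)) := by
    rw [← abs_of_pos hb, ← abs_mul, abs_of_pos hb, hid]
    refine (abs_add_le _ _).trans ((add_le_add e1 e2).trans (le_of_eq ?_))
    ring
  rw [h1 hx]
  calc |deriv v x - deriv ψ x| ≤ V * ((Λ * E + 1 + E * (μ * b)) * η) :=
        le_of_mul_le_mul_left e3 hb
    _ ≤ 2 * b * ((Λ * E + 1 + E * (μ * b)) * η) := by gcongr
    _ = _ := by ring

namespace Mesh

/-- Linear convergence of the normalized first eigenfunction in the energy seminorm. -/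
lemma exists_energySeminorm_sub_le {N : ℕ} (hN : 1 ≤ N) {μ : ℝ} {ψ : ℝ → ℝ}
    (hψ : RadialFEM.IsEigenfunction N μ ψ) (hψn : IsNormalized N ψ) :
    ∃ C h₀ : ℝ, 0 ≤ C ∧ 0 < h₀ ∧ ∀ M : Mesh, M.h ≤ h₀ →
      ∀ lam : ℝ, IsLeast (M.eigenvalues N) lam → ∀ v : ℝ → ℝ, M.IsEigenfunction N lam v →
        IsNormalized N v → energySeminorm N (fun x => v x - ψ x) ≤ C * M.h := by
  obtain ⟨hμ, hb, -⟩ := hψ.pos_of_isNormalized hψn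
  obtain ⟨C₁, hC₁, hconv⟩ := exists_abs_sub_le hN hψ hψn
  set Λ : ℝ := (N + 1 : ℝ) ^ 2 with hΛ
  set E : ℝ := 2 * Real.exp (2 * Λ) with hE
  set C₂ : ℝ := Λ * N + C₁ with hC₂
  have hE0 : 0 < E := by positivity
  have hC₂0 : 0 < C₂ := by
    have : (0 : ℝ) < N := by exact_mod_cast hN
    positivity
  -- `η = C₂ * h` covers the residual and the eigenvalue error; the second bound on `h` is the
  -- smallness condition of the stability lemma.
  refine ⟨2 * ψ 0 * (Λ * E + 1 + E * (μ * ψ 0)) * C₂, min 1 (1 / (2 * (ψ 0 * E * C₂))),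
    by positivity, by positivity, fun M hM lam hl v hv hvn => ?_⟩
  have hh := h_nonneg (M := M)
  have hlam := pos_of_isLeast hl
  have hlamΛ : lam ≤ Λ := le_of_isLeast hN hl
  rw [mul_assoc]
  refine hψ.energySeminorm_sub_le hN hψn hv.1.1.1 hvn (hv.apply_zero_pos hlam.le hvn.1) hlam.le
    hlamΛ (ρ := lam * N * M.h) ?_ ?_ (by positivity) rfl ?_
  · filter_upwards [hv.ae_abs_deriv_add_flux_le hN hlam.le hvn.1] with x hx hx'
    refine (hx hx').trans (le_of_eq ?_)
    ring
  · rw [hC₂, add_mul]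
    refine add_le_add ?_ (hconv M (hM.trans (min_le_left _ _)) lam hl)
    gcongr
  · have h1 := hM.trans (min_le_right _ _)
    rw [le_div_iff₀ (by positivity)] at h1
    linarith

end Mesh

end RadialFEM

end

theorem proposition5p4 (N : ℕ) (hN : 2 ≤ N) (β : ℝ) (hβ : 0 < β)
    (μ : ℝ) (hμ : IsLeast (RadialFEM.eigenvalues N) μ)
    (ψ : ℝ → ℝ) (hψ : RadialFEM.IsEigenfunction N μ ψ) (hψn : RadialFEM.IsNormalized N ψ) :
    -- the discrete problem has a smallest eigenvalue, and it is positive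
    (∀ M : RadialFEM.Mesh, M.QuasiUniform β →
      ∃ μh : ℝ, 0 < μh ∧ IsLeast (M.eigenvalues N) μh) ∧
    -- (i) it converges to `μ`
    (∀ ε : ℝ, 0 < ε → ∃ δ : ℝ, 0 < δ ∧ ∀ M : RadialFEM.Mesh, M.QuasiUniform β → M.h < δ →
      ∀ μh : ℝ, IsLeast (M.eigenvalues N) μh → |μh - μ| < ε) ∧
    -- (ii) the first discrete eigenfunctions do not change sign
    (∀ M : RadialFEM.Mesh, M.QuasiUniform β →
      ∀ μh : ℝ, IsLeast (M.eigenvalues N) μh → ∀ ψh : ℝ → ℝ, M.IsEigenfunction N μh ψh →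
        (∀ x ∈ Set.Icc (0 : ℝ) 1, 0 ≤ ψh x) ∨ (∀ x ∈ Set.Icc (0 : ℝ) 1, ψh x ≤ 0)) ∧
    -- (iii) the normalized first discrete eigenfunction converges to `ψ`
    (∀ ε : ℝ, 0 < ε → ∃ δ : ℝ, 0 < δ ∧ ∀ M : RadialFEM.Mesh, M.QuasiUniform β → M.h < δ →
      ∀ μh : ℝ, IsLeast (M.eigenvalues N) μh → ∀ ψh : ℝ → ℝ, M.IsEigenfunction N μh ψh →
        RadialFEM.IsNormalized N ψh →
        RadialFEM.energySeminorm N (fun x => ψh x - ψ x) < ε) := by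
  have hN1 : 1 ≤ N := by omega
  refine ⟨fun M _ => ?_, fun ε hε => ?_, fun M _ μh hμh ψh hψh => hψh.nonneg_or_nonpos hμh,
    fun ε hε => ?_⟩
  · obtain ⟨μh, h0, h1, _⟩ := RadialFEM.Mesh.exists_isLeast_eigenvalues M N
    exact ⟨μh, h0, h1⟩
  · obtain ⟨C, hC, hconv⟩ := RadialFEM.Mesh.exists_abs_sub_le hN1 hψ hψn
    -- `C + 1` replaces `C`, which may be zero.
    refine ⟨min 1 (ε / (C + 1)), by positivity, fun M _ hM μh hμh => ?_⟩
    have hM1 := hM.trans_le (min_le_left _ _)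
    have hM2 := hM.trans_le (min_le_right _ _)
    rw [lt_div_iff₀ (by positivity)] at hM2
    have hh := RadialFEM.Mesh.h_nonneg (M := M)
    have := hconv M hM1.le μh hμh
    linarith
  · obtain ⟨C, h₀, hC, hh₀, hconv⟩ := RadialFEM.Mesh.exists_energySeminorm_sub_le hN1 hψ hψn
    refine ⟨min h₀ (ε / (C + 1)), by positivity, fun M _ hM μh hμh ψh hψh hψhn => ?_⟩
    have hM1 := hM.trans_le (min_le_left _ _)
    have hM2 := hM.trans_le (min_le_right _ _)
    rw [lt_div_iff₀ (by positivity)] at hM2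
    have hh := RadialFEM.Mesh.h_nonneg (M := M)
    have := hconv M hM1.le μh hμh ψh hψh hψhn
    linarith
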